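/- **Setting.** Let $V$ be a finite set of sites, each carrying a spin with Hilbert space $\mathbb{C}^q$, and let $H=\sum_j h_j$ where each $h_j$ is a Hermitian operator acting on a finite set $Z_j\subseteq V$ of sites. Two sites are neighbours if some $Z_j$ contains both; $d(x,y)$ is the length of a shortest path of neighbours ($\infty$ if there is none), and $d(X,Y)=\min_{x\in X,y\in Y}d(x,y)$ for $X,Y\subseteq V$ ($\infty$ if $X$ or $Y$ is empty). For $R\subseteq V$ let $H_R=\sum_{j:Z_j\subseteq R}h_j$; its energies are its eigenvalues on the truncated space $(\mathbb{C}^q)^{\otimes R}$. For $X\subseteq V$ and real $l\ge 0$ write $H_X^l=H_R$ with $R=\{x: d(x,X)\le l\}$. An observable on $X$ is a Hermitian operator acting only on $X$ with operator norm $1$; $A(t)=e^{itH}Ae^{-itH}$. Let $E_k$ be the eigenvalues of $H$ (with multiplicity) and $\Theta(E)=\#\{k: E_k\le E\}$. We put $e^{-\mu\infty}=0$, and every bound below that contains $e^{-\mu d}$ with $d=\infty$ is read as $0$. * $H$ is *strongly dynamically localised* with constants $c_{\rm loc},\mu>0$ if $\|A(t)-e^{itH_X^l}Ae^{-itH_X^l}\|\le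 c_{\rm loc}e^{-\mu l}$ for all $X$, all observables $A$ on $X$, all real $l\ge0$ and all $t\ge0$. * $H$ has a *mobility edge* at $E_{\rm mob}$ with constants $c_{\rm mob},\mu>0$ if $|\mathrm{tr}(\rho[A(t),B])|\le \min(t,1)\,c_{\rm mob}\,e^{-\mu d(X,Y)}$ for all $t\ge 0$, all observables $A$ on $X$ and $B$ on $Y$ with $X\cap Y=\emptyset$, and all density operators $\rho$ in the linear span of the operators $|\varphi\rangle\langle\chi|$ with $\varphi,\chi$ eigenvectors of $H$ of energies $\le E_{\rm mob}$. * **AI**: the eigenvalues of $H$ are non-degenerate. * **AII** for two regions $R,S$: the energies $E_a$ of $H_R$ and $E_b$ of $H_S$ are non-degenerate on the truncated Hilbert spaces, and $E_a-E_{a'}=E_b-E_{b'}$ implies $a=a'$, $b=b'$. * **AIII**: there is $\zeta>0$ with $\bigl||E_r-E_k|-|E_s-E_k|\bigr|\ge\zeta$ for all $k$ and all $r\ne s$. **Theorem 1 (Clustering of correlations of eigenvectors).** Let $X,Y\subseteq V$ be disjoint, $d=d(X,Y)$, and let $A$, $B$ be observables on $X$, $Y$. **(a)** If $H$ is strongly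 dynamically localised with constants $c_{\rm loc},\mu$ and satisfies AI, and AII holds for the regions $\{x: 2d(x,X)<d\}$ and $\{x: 2d(x,Y)<d\}$, then every normalised eigenvector $|k\rangle$ of $H$ satisfies $$|\langle k|AB|k\rangle-\langle k|A|k\rangle\langle k|B|k\rangle|\le 4c_{\rm loc}\,e^{-\mu d/2}.$$ **(b)** If $H$ has a mobility edge at $E_{\rm mob}$ with constants $c_{\rm mob},\mu$ and satisfies AI and AIII, then for every normalised eigenvector $|k\rangle$ of energy $E_k\le E_{\rm mob}$ and every $\kappa>0$ $$|\langle k|AB|k\rangle-\langle k|A|k\rangle\langle k|B|k\rangle|\le\Bigl(12\pi\,\Theta(E_k+\kappa)\,c_{\rm mob}+2\pi+c_{\rm mob}\ln\bigl(e^{4}\max(1,\tfrac{\pi\mu d}{\kappa^2})\bigr)\Bigr)\frac{e^{-\mu d}}{2\pi}.$$ If moreover $d<\infty$, $\kappa^2\le e^4\pi\mu d$, and $c_{\rm mob}\le1$ or $\ln(\pi\mu d\,e^{4}/\kappa^2)\le 4\pi(2\Theta(E_k+\kappa)+1)$, then also $$|\langle k|AB|k\rangle-\langle k|A|k\rangle\langle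 k|B|k\rangle|\le\Bigl(12\pi\,\Theta(E_k+\kappa)\,c_{\rm mob}+\ln\frac{\pi\mu d\,e^{4+2\pi}}{\kappa^2}\Bigr)\frac{e^{-\mu d}}{2\pi}.$$ -/

import Mathlib

open scoped Matrix.Norms.L2Operator ComplexOrder

noncomputable section

namespace SpinLattice

/-- Classical configurations of a system of `q`-level spins on the sites `S`: they label the
product basis of the Hilbert space `(ℂ^q)^{⊗ S}`. -/
abbrev Conf (S : Type*) (q : ℕ) : Type _ := S → Fin q

/-- Operators on the Hilbert space `(ℂ^q)^{⊗ S}`, as matrices in the product basis. Their norm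
is the operator norm. -/
abbrev Op (S : Type*) (q : ℕ) : Type _ := Matrix (Conf S q) (Conf S q) ℂ

open Classical in
/-- For an injection `f : S → T` of sites, the operator `M ⊗ 1` on the sites `T` which acts as `M`
on the sites `f(S)` and as the identity on all the other sites. -/
def embed {S T : Type*} {q : ℕ} (f : S → T) (M : Op S q) : Op T q :=
  fun σ τ => if ∀ x, x ∉ Set.range f → σ x = τ x then M (σ ∘ f) (τ ∘ f) else 0

theorem embed_isHermitian {S T : Type*} {q : ℕ} (f : S → T) {M : Op S q}
    (hM : M.IsHermitian) : (embed f M).IsHermitian := by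
  ext σ τ
  simp only [Matrix.conjTranspose_apply, embed]
  by_cases h : ∀ x, x ∉ Set.range f → σ x = τ x
  · have h' : ∀ x, x ∉ Set.range f → τ x = σ x := fun x hx => (h x hx).symm
    rw [if_pos h, if_pos h', hM.apply]
  · have h' : ¬ ∀ x, x ∉ Set.range f → τ x = σ x := fun h' => h fun x hx => (h' x hx).symm
    rw [if_neg h, if_neg h', star_zero]

/-- A local Hamiltonian `H = ∑ j, h j` of `q`-level spins on the sites `V`: the term `h j` is a
Hermitian operator on the sites in `supp j`. -/
structure LocalHamiltonian (V ι : Type*) (q : ℕ) where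
  /-- the set of sites on which the `j`-th interaction acts -/
  supp : ι → Finset V
  /-- the `j`-th interaction -/
  term : (j : ι) → Op (supp j) q
  isHermitian_term : ∀ j, (term j).IsHermitian

/-- The Heisenberg evolution `e^{itG} A e^{-itG}`. -/
def heisenberg {S : Type*} [Fintype S] [DecidableEq S] {q : ℕ} (G : Op S q) (t : ℝ)
    (A : Op S q) : Op S q :=
  NormedSpace.exp ((Complex.I * (t : ℂ)) • G) * A * NormedSpace.exp (-(Complex.I * (t : ℂ)) • G)

/-- `A` is an observable of norm one which acts only on the sites in `X`. -/
def IsObservableOn {V : Type*} [Fintype V] [DecidableEq V] {q : ℕ} (X : Finset V)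
    (A : Op V q) : Prop :=
  A.IsHermitian ∧ (∃ a : Op X q, A = embed (Subtype.val : X → V) a) ∧ ‖A‖ = 1

/-- `ψ` is a normalised vector. -/
def IsUnitVector {S : Type*} [Fintype S] [DecidableEq S] {q : ℕ} (ψ : Conf S q → ℂ) : Prop :=
  star ψ ⬝ᵥ ψ = 1

/-- The expectation value `⟨ψ|A|ψ⟩`. -/
def expectation {S : Type*} [Fintype S] [DecidableEq S] {q : ℕ} (ψ : Conf S q → ℂ)
    (A : Op S q) : ℂ :=
  star ψ ⬝ᵥ (A.mulVec ψ)

/-- `e^{-μ D}`, which is `0` for `D = ∞`. -/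
def expDecay (μ : ℝ) (D : ℕ∞) : ℝ :=
  if D = ⊤ then 0 else Real.exp (-μ * (D.toNat : ℝ))

namespace LocalHamiltonian

variable {V ι : Type*} [Fintype ι] {q : ℕ}
variable (H : LocalHamiltonian V ι q)

/-- The full Hamiltonian `H = ∑ j, h j`. -/
def full : Op V q := ∑ j, embed (Subtype.val : H.supp j → V) (H.term j)

theorem full_isHermitian : H.full.IsHermitian := by
  unfold full Matrix.IsHermitian
  rw [Matrix.conjTranspose_sum]
  exact Finset.sum_congr rfl fun j _ => embed_isHermitian _ (H.isHermitian_term j)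

variable [DecidableEq V]

/-- The Hamiltonian made of all the interactions contained in the region `R`, as an operator on
the whole lattice. -/
def trunc (R : Finset V) : Op V q :=
  ∑ j with H.supp j ⊆ R, embed (Subtype.val : H.supp j → V) (H.term j)

/-- The Hamiltonian made of all the interactions contained in the region `R`, as an operator on
the truncated Hilbert space of the sites in `R`. -/
def region (R : Finset V) : Op R q :=
  ∑ j, if h : H.supp j ⊆ R then
    embed (fun x : H.supp j => (⟨x.1, h x.2⟩ : R)) (H.term j) else 0

theorem region_isHermitian (R : Finset V) : (H.region R).IsHermitian := by
  unfold region Matrix.IsHermitian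
  rw [Matrix.conjTranspose_sum]
  refine Finset.sum_congr rfl fun j _ => ?_
  split_ifs with h
  · exact embed_isHermitian _ (H.isHermitian_term j)
  · exact Matrix.conjTranspose_zero

variable [Fintype V]

/-- The energies of the full Hamiltonian, repeated according to multiplicity. -/
def energy : Conf V q → ℝ := H.full_isHermitian.eigenvalues

/-- The energies of the Hamiltonian of the region `R` on the truncated Hilbert space of `R`,
repeated according to multiplicity. -/
def regionEnergy (R : Finset V) : Conf R q → ℝ := (H.region_isHermitian R).eigenvalues

/-- The number `Θ(E)` of eigenstates of `H` of energy at most `E`. -/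
def numStates (E : ℝ) : ℕ := Nat.card {k : Conf V q // H.energy k ≤ E}

/-- `ψ` satisfies `H ψ = E ψ`. -/
def IsEigen (ψ : Conf V q → ℂ) (E : ℝ) : Prop := H.full.mulVec ψ = (E : ℂ) • ψ

/-- Two different sites are neighbours if some interaction acts on both. -/
def interactionGraph : SimpleGraph V where
  Adj x y := x ≠ y ∧ ∃ j, x ∈ H.supp j ∧ y ∈ H.supp j
  symm := ⟨fun _ _ h => ⟨h.1.symm, h.2.imp fun _ hj => ⟨hj.2, hj.1⟩⟩⟩
  loopless := ⟨fun _ h => h.1 rfl⟩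

/-- The distance `d(X, Y)` of two sets of sites: the length of the shortest path of interactions
that connects them (`∞` if there is none). -/
def dist (X Y : Finset V) : ℕ∞ := ⨅ x ∈ X, ⨅ y ∈ Y, H.interactionGraph.edist x y

open Classical in
/-- The sites at distance at most `l` from `X`. -/
def nbhd (X : Finset V) (l : ℝ) : Finset V :=
  {x | ∃ y ∈ X, H.interactionGraph.Reachable y x ∧ (H.interactionGraph.dist y x : ℝ) ≤ l}

open Classical in
/-- The sites whose distance from `X` is less than half of the distance `d(X, Y)`. -/
def halfway (X Y : Finset V) : Finset V :=
  {x | ∃ y ∈ X, 2 * H.interactionGraph.edist y x < H.dist X Y}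

/-- Strong dynamical localisation with constants `c` and `μ`. -/
def StrongDynamicalLocalisation (c μ : ℝ) : Prop :=
  0 < c ∧ 0 < μ ∧
    ∀ (X : Finset V) (A : Op V q), IsObservableOn X A → ∀ l : ℝ, 0 ≤ l → ∀ t : ℝ, 0 ≤ t →
      ‖heisenberg H.full t A - heisenberg (H.trunc (H.nbhd X l)) t A‖ ≤ c * Real.exp (-μ * l)

/-- The linear span of the operators `|φ⟩⟨χ|` for eigenvectors `φ`, `χ` of `H` of energy at most
`Emob`. -/
def lowEnergySpan (Emob : ℝ) : Submodule ℂ (Op V q) :=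
  Submodule.span ℂ {M | ∃ (φ χ : Conf V q → ℂ) (E E' : ℝ),
    H.IsEigen φ E ∧ H.IsEigen χ E' ∧ E ≤ Emob ∧ E' ≤ Emob ∧ M = Matrix.vecMulVec φ (star χ)}

/-- `H` has a mobility edge at the energy `Emob` with constants `c` and `μ`: zero velocity
commutator bounds hold in all states `ρ` supported on the energies up to `Emob`, for observables
with disjoint supports. -/
def HasMobilityEdge (Emob c μ : ℝ) : Prop :=
  0 < c ∧ 0 < μ ∧
    ∀ ρ : Op V q, ρ ∈ H.lowEnergySpan Emob → ρ.PosSemidef → ρ.trace = 1 →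
      ∀ (X Y : Finset V), Disjoint X Y → ∀ A B : Op V q,
        IsObservableOn X A → IsObservableOn Y B → ∀ t : ℝ, 0 ≤ t →
          ‖(ρ * (heisenberg H.full t A * B - B * heisenberg H.full t A)).trace‖ ≤
            min t 1 * c * expDecay μ (H.dist X Y)

/-- Non-degenerate energies. -/
def NondegenerateEnergies : Prop := Function.Injective H.energy

/-- Locally independent gaps, for the two regions `R` and `S`. -/
def LocallyIndependentGaps (R S : Finset V) : Prop :=
  Function.Injective (H.regionEnergy R) ∧ Function.Injective (H.regionEnergy S) ∧
    ∀ (a a' : Conf R q) (b b' : Conf S q),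
      H.regionEnergy R a - H.regionEnergy R a' = H.regionEnergy S b - H.regionEnergy S b' →
        a = a' ∧ b = b'

/-- Non-symmetric gaps. -/
def NonsymmetricGaps : Prop :=
  ∃ ζ : ℝ, 0 < ζ ∧ ∀ k r s : Conf V q, r ≠ s →
    ζ ≤ |(|H.energy r - H.energy k| - |H.energy s - H.energy k|)|

end LocalHamiltonian

end SpinLattice

end

/-! Both parts compare `⟨AB⟩` in an eigenvector with an average over time.

Part (a). An eigenvector gives `A B` the same expectation as `A(t) B(t)` at every time. Localisation
replaces the factors by evolutions inside the two halfway regions at a cost of `2δ`, where `δ = c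
e^{-μ l}`. AII says that the only vanishing sums of a gap of one region and a gap of the other are
the trivial ones, so the time mean of the product of the truncated evolutions is the product of
their means. These means are `δ`-close to those of the full evolution, which by AI dephase `A` and
`B` in the eigenbasis; replacing them costs another `2δ`. Dephased operators are diagonal, so their
product has expectation `⟨A⟩⟨B⟩`. This is `norm_correlation_le_of_local`; letting `l` tend to `d/2`
gives the rate.

Part (b). Put `C j = ⟨A P_j B⟩`, with `P_j` the projection onto the `j`-th eigenvector, and `F(t) =
⟨A(t) B⟩ = ∑ j, e^{i(E - E_j)t} C j`. The `C j` with `j ≠ k` sum to the correlation. The mobility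
edge bounds `F - conj F`, the expectation of the commutator, by `min(t,1) ε` with `ε = c e^{-μ d}`.
Averaging against a single frequency shows `‖C j‖ ≤ ε`, since AIII separates the moduli of the
frequencies (`norm_coeff_le_of_norm_sub_conj_le`). Integrating against `e^{-α t²}/t` bounds the sum
of the `C j` weighted by a smoothed sign of `E_j - E` (`abs_sum_re_mul_smoothSign_le`). Replacing
that weight by `1` costs at most `2ε` for each other level up to `E + κ`, and a Gaussian tail for
all the higher levels together. The width `α` is chosen so that the tail is at most `e^{-μ d}`. -/

/-! ### Functional calculus of a Hermitian matrix -/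

section Spectral

open Matrix

variable {n : Type*} [Fintype n] [DecidableEq n] {G : Matrix n n ℂ}

namespace Matrix.IsHermitian

/-- The operator `∑ i, w i |v i⟩⟨v i|` for the eigenvectors `v i` of a Hermitian matrix. -/
noncomputable def spectralSum (hG : G.IsHermitian) (w : n → ℂ) : Matrix n n ℂ :=
  (hG.eigenvectorUnitary : Matrix n n ℂ) * diagonal w *
    star (hG.eigenvectorUnitary : Matrix n n ℂ)

/-- The projection `|v i⟩⟨v i|` onto the `i`-th eigenvector of a Hermitian matrix. -/
noncomputable def eigenProj (hG : G.IsHermitian) (i : n) : Matrix n n ℂ :=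
  hG.spectralSum (Pi.single i 1)

variable (hG : G.IsHermitian)

theorem spectralSum_mul (v w : n → ℂ) :
    hG.spectralSum v * hG.spectralSum w = hG.spectralSum (v * w) := by
  have h : star (hG.eigenvectorUnitary : Matrix n n ℂ) * (hG.eigenvectorUnitary : Matrix n n ℂ)
      = 1 := Unitary.coe_star_mul_self _
  unfold spectralSum
  calc _ = (hG.eigenvectorUnitary : Matrix n n ℂ) * diagonal v *
        (star (hG.eigenvectorUnitary : Matrix n n ℂ) * (hG.eigenvectorUnitary : Matrix n n ℂ)) *
        diagonal w * star (hG.eigenvectorUnitary : Matrix n n ℂ) := by simp only [mul_assoc]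
    _ = _ := by
      rw [h, mul_one, mul_assoc _ (diagonal v), diagonal_mul_diagonal]; rfl

theorem spectralSum_eq_sum (w : n → ℂ) : hG.spectralSum w = ∑ i, w i • hG.eigenProj i := by
  have h : diagonal w = ∑ i, w i • diagonal (Pi.single i (1 : ℂ)) := by
    ext a b
    simp only [diagonal_apply, sum_apply, smul_apply, smul_eq_mul]
    split_ifs <;> simp [Pi.single_apply]
  unfold eigenProj spectralSum
  rw [h]
  simp only [Finset.sum_mul, Finset.mul_sum, mul_smul_comm, smul_mul_assoc]

theorem spectralSum_one : hG.spectralSum 1 = 1 := by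
  unfold spectralSum
  rw [show diagonal (1 : n → ℂ) = 1 from diagonal_one, mul_one]
  exact Unitary.coe_mul_star_self _

theorem spectralSum_eigenvalues : hG.spectralSum (fun i => (hG.eigenvalues i : ℂ)) = G := by
  conv_rhs => rw [hG.spectral_theorem, Unitary.conjStarAlgAut_apply]
  rfl

theorem sum_eigenProj : ∑ i, hG.eigenProj i = 1 := by
  rw [← hG.spectralSum_one, spectralSum_eq_sum]; simp

theorem eigenProj_mul_eigenProj (i j : n) :
    hG.eigenProj i * hG.eigenProj j = if i = j then hG.eigenProj i else 0 := by
  unfold eigenProj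
  rw [spectralSum_mul]
  split_ifs with h
  · subst h; congr 1; ext a; by_cases ha : a = i <;> simp [ha]
  · have : (Pi.single i 1 * Pi.single j 1 : n → ℂ) = 0 := by
      ext a
      by_cases ha : a = i
      · subst ha; simp [h]
      · simp [ha]
    rw [this]; simp [spectralSum]

theorem eigenProj_mul_self (i : n) :
    hG.eigenProj i * G = (hG.eigenvalues i : ℂ) • hG.eigenProj i := by
  have h := congrArg (hG.eigenProj i * ·) hG.spectralSum_eigenvalues
  simp only [spectralSum_eq_sum, Finset.mul_sum, mul_smul_comm, eigenProj_mul_eigenProj] at h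
  rw [← h]
  simp

theorem isHermitian_eigenProj (i : n) : (hG.eigenProj i).IsHermitian := by
  unfold eigenProj spectralSum Matrix.IsHermitian
  simp only [conjTranspose_mul, star_eq_conjTranspose, conjTranspose_conjTranspose,
    diagonal_conjTranspose, ← mul_assoc]
  congr 3
  ext a; by_cases ha : a = i
  · subst ha; simp
  · simp [ha]

theorem eigenProj_eq_vecMulVec (i : n) : hG.eigenProj i =
    vecMulVec ((hG.eigenvectorUnitary : Matrix n n ℂ).col i)
      (star ((hG.eigenvectorUnitary : Matrix n n ℂ).col i)) := by
  ext a b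
  simp [eigenProj, spectralSum, mul_apply, vecMulVec_apply, diagonal_apply, Pi.single_apply, col]

theorem norm_spectralSum_le {w : n → ℂ} {C : ℝ} (hC : 0 ≤ C) (hw : ∀ i, ‖w i‖ ≤ C) :
    ‖hG.spectralSum w‖ ≤ C := by
  unfold spectralSum
  rw [← Unitary.coe_star, CStarRing.norm_mul_coe_unitary, CStarRing.norm_coe_unitary_mul,
    l2_opNorm_diagonal]
  exact (pi_norm_le_iff_of_nonneg hC).2 hw

theorem exp_smul_eq (z : ℂ) : NormedSpace.exp (z • G) =
    hG.spectralSum (fun i => Complex.exp (z * hG.eigenvalues i)) := by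
  conv_lhs => rw [← hG.spectralSum_eigenvalues]
  unfold spectralSum
  rw [← smul_mul_assoc, ← mul_smul_comm, ← diagonal_smul]
  have hinv : star (hG.eigenvectorUnitary : Matrix n n ℂ)
      = (hG.eigenvectorUnitary : Matrix n n ℂ)⁻¹ :=
    (inv_eq_left_inv (Unitary.coe_star_mul_self _)).symm
  have hu : IsUnit (hG.eigenvectorUnitary : Matrix n n ℂ) :=
    (Unitary.toUnits hG.eigenvectorUnitary).isUnit
  rw [hinv, exp_conj _ _ hu, exp_diagonal]
  congr 3
  ext i
  rw [Pi.coe_exp]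
  simp [Complex.exp_eq_exp_ℂ]

end Matrix.IsHermitian

end Spectral

/-! ### Heisenberg evolution and expectation values -/

namespace SpinLattice

open Matrix

variable {S : Type*} [Fintype S] [DecidableEq S] {q : ℕ}

theorem heisenberg_eq_sum {G : Op S q} (hG : G.IsHermitian) (t : ℝ) (A : Op S q) :
    heisenberg G t A = ∑ i, ∑ j,
      Complex.exp (Complex.I * ((hG.eigenvalues i - hG.eigenvalues j : ℝ) : ℂ) * t) •
        (hG.eigenProj i * A * hG.eigenProj j) := by
  unfold heisenberg
  rw [hG.exp_smul_eq, hG.exp_smul_eq, hG.spectralSum_eq_sum, hG.spectralSum_eq_sum]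
  simp only [Finset.sum_mul, Finset.mul_sum, smul_mul_assoc, mul_smul_comm, Finset.smul_sum]
  rw [Finset.sum_comm]
  refine Finset.sum_congr rfl fun i _ => ?_
  apply Finset.sum_congr rfl; intro j _
  rw [smul_smul, ← Complex.exp_add]
  congr 2
  push_cast; ring

theorem exp_mem_unitary {G : Op S q} (hG : G.IsHermitian) (t : ℝ) :
    NormedSpace.exp ((Complex.I * (t : ℂ)) • G) ∈ unitary (Op S q) := by
  let _ : NormedAlgebra ℚ (Op S q) := NormedAlgebra.restrictScalars ℚ ℂ (Op S q)
  refine NormedSpace.exp_mem_unitary_of_mem_skewAdjoint ?_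
  rw [skewAdjoint.mem_iff, star_smul, star_eq_conjTranspose, hG.eq]
  simp

theorem star_exp {G : Op S q} (hG : G.IsHermitian) (t : ℝ) :
    star (NormedSpace.exp ((Complex.I * (t : ℂ)) • G))
      = NormedSpace.exp (-(Complex.I * (t : ℂ)) • G) := by
  rw [NormedSpace.star_exp, star_smul, star_eq_conjTranspose, hG.eq]
  simp

theorem norm_heisenberg {G : Op S q} (hG : G.IsHermitian) (t : ℝ) (A : Op S q) :
    ‖heisenberg G t A‖ = ‖A‖ := by
  unfold heisenberg
  have h := exp_mem_unitary hG t
  rw [← star_exp hG]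
  rw [CStarRing.norm_mul_mem_unitary _ (Unitary.star_mem h), CStarRing.norm_mem_unitary_mul _ h]

theorem heisenberg_mul {G : Op S q} (hG : G.IsHermitian) (t : ℝ) (A B : Op S q) :
    heisenberg G t A * heisenberg G t B = heisenberg G t (A * B) := by
  unfold heisenberg
  have h := (Unitary.mem_iff.1 (exp_mem_unitary hG t)).1
  rw [star_exp hG] at h
  calc _ = NormedSpace.exp ((Complex.I * (t : ℂ)) • G) * A *
        (NormedSpace.exp (-(Complex.I * (t : ℂ)) • G) *
          NormedSpace.exp ((Complex.I * (t : ℂ)) • G)) * B *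
        NormedSpace.exp (-(Complex.I * (t : ℂ)) • G) := by simp only [mul_assoc]
    _ = _ := by rw [h]; simp only [mul_assoc, one_mul]

/-- The expectation value in the state `ψ` as a linear functional. -/
def expectationLin (ψ : Conf S q → ℂ) : Op S q →ₗ[ℂ] ℂ where
  toFun := expectation ψ
  map_add' A B := by simp [expectation, add_mulVec]
  map_smul' c A := by simp [expectation, smul_mulVec]

theorem expectationLin_apply (ψ : Conf S q → ℂ) (A : Op S q) :
    expectationLin ψ A = expectation ψ A := rfl

theorem expectation_conjTranspose (ψ : Conf S q → ℂ) (A : Op S q) :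
    expectation ψ Aᴴ = star (expectation ψ A) := by
  unfold expectation
  rw [← star_dotProduct_star, star_star, star_mulVec, dotProduct_mulVec]

theorem norm_expectation_le {ψ : Conf S q → ℂ} (hψ : IsUnitVector ψ) (A : Op S q) :
    ‖expectation ψ A‖ ≤ ‖A‖ := by
  have hn : ‖WithLp.toLp 2 ψ‖ = 1 := by
    have : inner ℂ (WithLp.toLp 2 ψ) (WithLp.toLp 2 ψ) = (1 : ℂ) := by
      rw [EuclideanSpace.inner_toLp_toLp, dotProduct_comm]; exact hψ
    rw [inner_self_eq_norm_sq_to_K] at this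
    have h2 : ‖WithLp.toLp 2 ψ‖ ^ 2 = 1 := by
      have := congrArg Complex.re this
      norm_cast at this
    nlinarith [norm_nonneg (WithLp.toLp 2 ψ)]
  have : expectation ψ A = inner ℂ (WithLp.toLp 2 ψ) (WithLp.toLp 2 (A *ᵥ ψ)) := by
    rw [EuclideanSpace.inner_toLp_toLp, dotProduct_comm]; rfl
  rw [this]
  refine (norm_inner_le_norm _ _).trans ?_
  rw [hn, one_mul]
  have := A.l2_opNorm_mulVec (WithLp.toLp 2 ψ)
  rw [hn, mul_one] at this
  exact this

/-- For a normalised eigenvector `ψ` of a Hermitian operator with non-degenerate spectrum, one of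
the spectral projections is `|ψ⟩⟨ψ|`. -/
theorem exists_eigenProj_eq {G : Op S q} (hG : G.IsHermitian)
    (hinj : Function.Injective hG.eigenvalues) {ψ : Conf S q → ℂ} (hψ : IsUnitVector ψ) {E : ℝ}
    (hE : G.mulVec ψ = (E : ℂ) • ψ) :
    ∃ k, hG.eigenvalues k = E ∧ hG.eigenProj k = vecMulVec ψ (star ψ) ∧
      ∀ i, hG.eigenProj i *ᵥ ψ = if i = k then ψ else 0 := by
  have h1 : ∀ i, hG.eigenvalues i ≠ E → hG.eigenProj i *ᵥ ψ = 0 := by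
    intro i hi
    have h := congrArg (fun v => hG.eigenProj i *ᵥ v) hE
    simp only [mulVec_mulVec, hG.eigenProj_mul_self, smul_mulVec, mulVec_smul] at h
    rw [← sub_eq_zero, ← sub_smul, smul_eq_zero] at h
    rcases h with h | h
    · exact absurd (by exact_mod_cast sub_eq_zero.1 h) hi
    · exact h
  have hsum : ∑ i, hG.eigenProj i *ᵥ ψ = ψ := by
    rw [← sum_mulVec, hG.sum_eigenProj, one_mulVec]
  have hne : ψ ≠ 0 := by rintro rfl; simp [IsUnitVector] at hψ
  obtain ⟨k, hk⟩ : ∃ k, hG.eigenvalues k = E := by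
    by_contra! hcon
    exact hne (by rw [← hsum]; exact Finset.sum_eq_zero fun i _ => h1 i (hcon i))
  have h2 : ∀ i, i ≠ k → hG.eigenProj i *ᵥ ψ = 0 := fun i hi =>
    h1 i fun h => hi (hinj (h.trans hk.symm))
  have h3 : hG.eigenProj k *ᵥ ψ = ψ := by
    rw [Finset.sum_eq_single k (fun i _ => h2 i) (by simp)] at hsum
    exact hsum
  refine ⟨k, hk, ?_, fun i => ?_⟩
  -- The chosen eigenvector `v` and `ψ` differ by a phase `z`, which cancels in the projection.
  · set v := (hG.eigenvectorUnitary : Matrix (Conf S q) (Conf S q) ℂ).col k with hv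
    have hP : hG.eigenProj k = vecMulVec v (star v) := hG.eigenProj_eq_vecMulVec k
    have hz : ψ = (star v ⬝ᵥ ψ) • v := by
      conv_lhs => rw [← h3, hP, vecMulVec_mulVec]
      ext; simp [mul_comm]
    set z := star v ⬝ᵥ ψ
    have hvv : star v ⬝ᵥ v = 1 := by
      have h := congrFun (congrFun (Unitary.coe_star_mul_self hG.eigenvectorUnitary) k) k
      simpa [mul_apply, dotProduct, v, col] using h
    have hzz : star z * z = 1 := by
      have := hψ
      unfold IsUnitVector at this
      rw [hz, star_smul, smul_dotProduct, dotProduct_smul, hvv] at this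
      simpa using this
    rw [hP, hz, star_smul, vecMulVec_smul, smul_vecMulVec, smul_smul, hzz, one_smul]
  · split_ifs with h
    · rw [h, h3]
    · exact h2 i h

theorem vecMulVec_mul_mul_vecMulVec (ψ : Conf S q → ℂ) (A : Op S q) :
    vecMulVec ψ (star ψ) * A * vecMulVec ψ (star ψ) =
      expectation ψ A • vecMulVec ψ (star ψ) := by
  rw [vecMulVec_mul, vecMulVec_mul_vecMulVec, ← dotProduct_mulVec, vecMulVec_smul]
  rfl

end SpinLattice

/-! ### Time averages -/

section TimeAverage

open MeasureTheory Filter Topology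

/-- The continuous function `f` has the limit `m` of its averages over `[0, T]`. -/
def HasTimeMean {F : Type*} [NormedAddCommGroup F] [NormedSpace ℝ F] (f : ℝ → F) (m : F) : Prop :=
  Continuous f ∧ Tendsto (fun T : ℝ => T⁻¹ • ∫ t in (0 : ℝ)..T, f t) atTop (𝓝 m)

namespace HasTimeMean

variable {F F' : Type*} [NormedAddCommGroup F] [NormedSpace ℝ F] [NormedAddCommGroup F']
  [NormedSpace ℝ F'] {f g : ℝ → F} {m m' : F}

theorem sub (hf : HasTimeMean f m) (hg : HasTimeMean g m') :
    HasTimeMean (fun t => f t - g t) (m - m') := by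
  refine ⟨hf.1.sub hg.1, (hf.2.sub hg.2).congr fun T => ?_⟩
  rw [intervalIntegral.integral_sub (hf.1.intervalIntegrable _ _) (hg.1.intervalIntegrable _ _),
    smul_sub]

theorem sum {ι : Type*} {s : Finset ι} {f : ι → ℝ → F} {m : ι → F}
    (h : ∀ i ∈ s, HasTimeMean (f i) (m i)) :
    HasTimeMean (fun t => ∑ i ∈ s, f i t) (∑ i ∈ s, m i) := by
  refine ⟨continuous_finsetSum _ fun i hi => (h i hi).1,
    (tendsto_finsetSum _ fun i hi => (h i hi).2).congr fun T => ?_⟩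
  rw [intervalIntegral.integral_finsetSum fun i hi => (h i hi).1.intervalIntegrable _ _,
    Finset.smul_sum]

/-- The averages run over `[0, T]`, so bounds at nonnegative times, all that the localisation
hypotheses supply, pass to the mean. -/
theorem norm_le (hf : HasTimeMean f m) {C : ℝ} (hC : ∀ t, 0 ≤ t → ‖f t‖ ≤ C) : ‖m‖ ≤ C := by
  refine le_of_tendsto hf.2.norm ?_
  filter_upwards [eventually_gt_atTop 0] with T hT
  have h := intervalIntegral.norm_integral_le_of_norm_le_const (a := 0) (b := T) (C := C) (f := f)
    fun t ht => hC t (by rw [Set.uIoc_of_le hT.le] at ht; exact ht.1.le)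
  rw [sub_zero, abs_of_pos hT] at h
  rw [norm_smul, norm_inv, Real.norm_of_nonneg hT.le, inv_mul_le_iff₀ hT]
  linarith

theorem clm (hf : HasTimeMean f m) [CompleteSpace F] [CompleteSpace F'] (L : F →L[ℝ] F') :
    HasTimeMean (fun t => L (f t)) (L m) := by
  refine ⟨L.continuous.comp hf.1, ((L.continuous.tendsto m).comp hf.2).congr fun T => ?_⟩
  rw [L.intervalIntegral_comp_comm (hf.1.intervalIntegrable _ _), Function.comp_apply, map_smul]

theorem congr (hf : HasTimeMean f m) (h : ∀ t, g t = f t) : HasTimeMean g m := by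
  rwa [show g = f from funext h]

theorem const [CompleteSpace F] (m : F) : HasTimeMean (fun _ => m) m := by
  refine ⟨continuous_const, tendsto_const_nhds.congr' ?_⟩
  filter_upwards [eventually_gt_atTop 0] with T hT
  rw [intervalIntegral.integral_const, sub_zero, smul_smul, inv_mul_cancel₀ hT.ne', one_smul]

end HasTimeMean

theorem hasTimeMean_exp (ω : ℝ) :
    HasTimeMean (fun t : ℝ => Complex.exp (Complex.I * (ω : ℂ) * t)) (if ω = 0 then 1 else 0) := by
  split_ifs with h
  · subst h; simpa using HasTimeMean.const (1 : ℂ)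
  · refine ⟨by fun_prop, ?_⟩
    have hc : Complex.I * (ω : ℂ) ≠ 0 := by simp [h]
    refine squeeze_zero_norm' (a := fun T : ℝ => T⁻¹ * (2 / |ω|)) ?_ ?_
    · filter_upwards [eventually_gt_atTop 0] with T hT
      rw [integral_exp_mul_complex hc, norm_smul, norm_inv, Real.norm_of_nonneg hT.le, norm_div]
      have h1 : ‖Complex.exp (Complex.I * ω * T)‖ = 1 := by
        rw [show Complex.I * (ω : ℂ) * T = ((ω * T : ℝ) : ℂ) * Complex.I by push_cast; ring]
        exact Complex.norm_exp_ofReal_mul_I _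
      have h2 : ‖Complex.exp (Complex.I * ω * T) - Complex.exp (Complex.I * ω * (0 : ℝ))‖ ≤ 2 := by
        refine (norm_sub_le _ _).trans ?_
        rw [h1]; simp; norm_num
      have h3 : ‖Complex.I * (ω : ℂ)‖ = |ω| := by simp
      rw [h3]
      gcongr
    · simpa using tendsto_inv_atTop_zero.mul_const (2 / |ω|)

theorem hasTimeMean_exp_smul {F : Type*} [NormedAddCommGroup F] [NormedSpace ℂ F]
    [CompleteSpace F] (ω : ℝ) (M : F) :
    HasTimeMean (fun t : ℝ => Complex.exp (Complex.I * (ω : ℂ) * t) • M)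
      (if ω = 0 then M else 0) := by
  have h := hasTimeMean_exp ω
  refine ⟨h.1.smul continuous_const, ?_⟩
  have h2 := h.2.smul_const M
  refine (h2.congr fun T => ?_).trans (by split_ifs <;> simp)
  rw [intervalIntegral.integral_smul_const, smul_assoc]

end TimeAverage

/-! ### Operators on regions, and the time means of their evolutions -/

namespace SpinLattice

open Matrix Kronecker

theorem embed_embed {S T W : Type*} {q : ℕ} {f : S → T} {g : T → W} (hg : Function.Injective g)
    (M : Op S q) : embed g (embed f M) = embed (g ∘ f) M := by
  ext σ τ
  simp only [embed]
  by_cases h : ∀ x, x ∉ Set.range (g ∘ f) → σ x = τ x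
  · have h1 : ∀ x, x ∉ Set.range g → σ x = τ x := fun x hx =>
      h x fun ⟨s, hs⟩ => hx ⟨f s, hs⟩
    have h2 : ∀ y, y ∉ Set.range f → (σ ∘ g) y = (τ ∘ g) y := fun y hy =>
      h (g y) fun ⟨s, hs⟩ => hy ⟨s, hg hs⟩
    rw [if_pos h, if_pos h1, if_pos h2]; rfl
  · rw [if_neg h]
    split_ifs with h1 h2
    · refine absurd (fun x hx => ?_) h
      by_cases hx' : x ∈ Set.range g
      · obtain ⟨y, rfl⟩ := hx'
        exact h2 y fun ⟨s, hs⟩ => hx ⟨s, by simp [hs]⟩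
      · exact h1 x hx'
    · rfl
    · rfl

section Region

variable {V : Type*} [Fintype V] [DecidableEq V] {q : ℕ} (R : Finset V)

/-- Splitting a configuration into its parts inside and outside `R` turns the embedding into a
Kronecker product, from which multiplicativity follows. -/
theorem embed_val_eq (M : Op R q) : embed (Subtype.val : R → V) M =
    (M ⊗ₖ (1 : Matrix ({x // x ∉ R} → Fin q) ({x // x ∉ R} → Fin q) ℂ)).submatrix
      (Equiv.piEquivPiSubtypeProd (· ∈ R) fun _ => Fin q)
      (Equiv.piEquivPiSubtypeProd (· ∈ R) fun _ => Fin q) := by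
  ext σ τ
  change _ = M (σ ∘ Subtype.val) (τ ∘ Subtype.val) *
    (1 : Matrix ({x // x ∉ R} → Fin q) ({x // x ∉ R} → Fin q) ℂ)
      (fun x => σ x.1) (fun x => τ x.1)
  have h : (∀ x, x ∉ Set.range (Subtype.val : R → V) → σ x = τ x) ↔
      (fun x : {x // x ∉ R} => σ x.1) = (fun x : {x // x ∉ R} => τ x.1) := by
    rw [funext_iff]
    simp
  unfold embed
  by_cases h' : ∀ x, x ∉ Set.range (Subtype.val : R → V) → σ x = τ x
  · rw [if_pos h', h.1 h', one_apply_eq, mul_one]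
  · rw [if_neg h', one_apply_ne fun h'' => h' (h.2 h''), mul_zero]

/-- The embedding `M ↦ M ⊗ 1` of the operators on a region as a homomorphism of algebras. -/
noncomputable def embedHom : Op R q →ₐ[ℂ] Op V q :=
  AlgHom.ofLinearMap
    { toFun := embed (Subtype.val : R → V)
      map_add' := fun M N => by
        ext; simp only [embed, Matrix.add_apply]; split_ifs <;> simp
      map_smul' := fun c M => by ext; simp [embed] }
    (by
      change embed (Subtype.val : R → V) 1 = 1
      rw [embed_val_eq, one_kronecker_one, submatrix_one_equiv])
    (fun M N => by
      change embed (Subtype.val : R → V) (M * N) =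
        embed (Subtype.val : R → V) M * embed (Subtype.val : R → V) N
      simp only [embed_val_eq]
      rw [submatrix_mul_equiv, ← mul_kronecker_mul, one_mul])

theorem embedHom_apply (M : Op R q) : embedHom R M = embed (Subtype.val : R → V) M := rfl

theorem embedHom_heisenberg (G : Op R q) (t : ℝ) (A : Op R q) :
    embedHom R (heisenberg G t A) = heisenberg (embedHom R G) t (embedHom R A) := by
  let _ : NormedAlgebra ℚ (Op V q) := NormedAlgebra.restrictScalars ℚ ℂ (Op V q)
  let _ : NormedAlgebra ℚ (Op R q) := NormedAlgebra.restrictScalars ℚ ℂ (Op R q)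
  have hc : Continuous (embedHom R : Op R q →ₐ[ℂ] Op V q) :=
    (embedHom R : Op R q →ₐ[ℂ] Op V q).toLinearMap.continuous_of_finiteDimensional
  unfold heisenberg
  rw [map_mul, map_mul, NormedSpace.map_exp _ hc, NormedSpace.map_exp _ hc, map_smul, map_smul]

theorem IsObservableOn.exists_embedHom {X : Finset V} {A : Op V q} (hA : IsObservableOn X A)
    (hX : X ⊆ R) : ∃ a : Op R q, A = embedHom R a := by
  obtain ⟨a, ha⟩ := hA.2.1
  refine ⟨embed (fun x : X => (⟨x.1, hX x.2⟩ : R)) a, ?_⟩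
  rw [embedHom_apply, embed_embed Subtype.val_injective, ha]
  rfl

/-- On the whole lattice the truncated Hamiltonian is in general highly degenerate. This identity
lets its evolution be expanded in the energies of the region, to which AII applies. -/
theorem LocalHamiltonian.trunc_eq_embedHom {ι : Type*} [Fintype ι] (H : LocalHamiltonian V ι q) :
    H.trunc R = embedHom R (H.region R) := by
  unfold trunc region
  rw [map_sum, Finset.sum_filter]
  refine Finset.sum_congr rfl fun j _ => ?_
  split_ifs with h
  · rw [embedHom_apply, embed_embed Subtype.val_injective]; rfl
  · simp

theorem LocalHamiltonian.isHermitian_trunc {ι : Type*} [Fintype ι] (H : LocalHamiltonian V ι q) :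
    (H.trunc R).IsHermitian := by
  rw [trunc_eq_embedHom]
  exact embed_isHermitian _ (H.region_isHermitian R)

/-- The evolution of a local observable under the Hamiltonian of a region in terms of the
energies of the region. -/
theorem heisenberg_embedHom_eq_sum {G : Op R q} (hG : G.IsHermitian) (t : ℝ) (a : Op R q) :
    heisenberg (embedHom R G) t (embedHom R a) = ∑ i, ∑ j,
      Complex.exp (Complex.I * ((hG.eigenvalues i - hG.eigenvalues j : ℝ) : ℂ) * t) •
        embedHom R (hG.eigenProj i * a * hG.eigenProj j) := by
  rw [← embedHom_heisenberg, heisenberg_eq_sum hG]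
  simp only [map_sum, map_smul]

end Region

section TimeMean

/-- The time mean of a function with non-degenerate frequencies `E i - E j`. -/
theorem hasTimeMean_gaps {F n : Type*} [NormedAddCommGroup F] [NormedSpace ℂ F] [CompleteSpace F]
    [Fintype n] {E : n → ℝ} (hE : Function.Injective E) (M : n → n → F) :
    HasTimeMean (fun t : ℝ => ∑ i, ∑ j,
      Complex.exp (Complex.I * ((E i - E j : ℝ) : ℂ) * t) • M i j) (∑ i, M i i) := by
  classical
  have h : ∑ i, M i i = ∑ i, ∑ j, if E i - E j = 0 then M i j else 0 := by
    refine Finset.sum_congr rfl fun i _ => ?_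
    rw [Finset.sum_eq_single i]
    · simp
    · intro j _ hj
      rw [if_neg]
      exact fun h => hj (hE (sub_eq_zero.1 h)).symm
    · simp
  rw [h]
  exact HasTimeMean.sum fun i _ => HasTimeMean.sum fun j _ => hasTimeMean_exp_smul _ _

/-- The time mean of a product factorises if the gaps of the two factors are independent. -/
theorem hasTimeMean_gaps_mul {F n m : Type*} [NormedRing F] [NormedAlgebra ℂ F] [CompleteSpace F]
    [Fintype n] [Fintype m] {E : n → ℝ} {E' : m → ℝ}
    (hE : ∀ a a' b b', E a - E a' = E' b - E' b' → a = a' ∧ b = b')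
    (M : n → n → F) (N : m → m → F) :
    HasTimeMean (fun t : ℝ =>
      (∑ i, ∑ j, Complex.exp (Complex.I * ((E i - E j : ℝ) : ℂ) * t) • M i j) *
      (∑ i, ∑ j, Complex.exp (Complex.I * ((E' i - E' j : ℝ) : ℂ) * t) • N i j))
      ((∑ i, M i i) * ∑ i, N i i) := by
  classical
  have h : (∑ i, M i i) * (∑ i, N i i) = ∑ i, ∑ j, ∑ i', ∑ j',
      if (E i - E j) + (E' i' - E' j') = 0 then M i j * N i' j' else 0 := by
    rw [Finset.sum_mul]
    refine Finset.sum_congr rfl fun i _ => ?_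
    rw [Finset.sum_eq_single i, Finset.mul_sum]
    · refine Finset.sum_congr rfl fun i' _ => ?_
      rw [Finset.sum_eq_single i']
      · simp
      · intro j' _ hj
        rw [if_neg]
        -- The gap of the second factor enters with the opposite sign, hence the order `j' i'`.
        exact fun h => hj (hE i i j' i' (by linarith)).2
      · simp
    · intro j _ hj
      refine Finset.sum_eq_zero fun i' _ => Finset.sum_eq_zero fun j' _ => ?_
      rw [if_neg]
      exact fun h => hj (hE i j j' i' (by linarith)).1.symm
    · simp
  rw [h]
  have := HasTimeMean.sum (s := Finset.univ) fun i _ => HasTimeMean.sum (s := Finset.univ)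
    fun j _ => HasTimeMean.sum (s := Finset.univ) fun i' _ => HasTimeMean.sum (s := Finset.univ)
    fun j' _ => hasTimeMean_exp_smul ((E i - E j) + (E' i' - E' j')) (M i j * N i' j')
  refine ⟨by fun_prop, this.2.congr fun T => ?_⟩
  congr 2
  ext t
  simp only [Finset.sum_mul]
  refine Finset.sum_congr rfl fun i _ => Finset.sum_congr rfl fun j _ => ?_
  simp only [Finset.mul_sum, smul_mul_smul_comm, ← Complex.exp_add]
  refine Finset.sum_congr rfl fun i' _ => Finset.sum_congr rfl fun j' _ => ?_
  congr 2
  push_cast; ring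

/-- Dephasing in a non-degenerate eigenbasis removes the correlations of the eigenvectors. -/
theorem expectation_dephase_mul {S : Type*} [Fintype S] [DecidableEq S] {q : ℕ} {G : Op S q}
    (hG : G.IsHermitian) (hinj : Function.Injective hG.eigenvalues) {ψ : Conf S q → ℂ}
    (hψ : IsUnitVector ψ) {E : ℝ} (hE : G.mulVec ψ = (E : ℂ) • ψ) (A B : Op S q) :
    expectation ψ ((∑ i, hG.eigenProj i * A * hG.eigenProj i) *
      ∑ i, hG.eigenProj i * B * hG.eigenProj i) = expectation ψ A * expectation ψ B := by
  obtain ⟨k, -, hP, hv⟩ := exists_eigenProj_eq hG hinj hψ hE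
  -- A dephased operator has `ψ` as an eigenvector, with its expectation as the eigenvalue; no other
  -- eigenvector can appear between the two factors.
  have h : ∀ C : Op S q, (∑ i, hG.eigenProj i * C * hG.eigenProj i) *ᵥ ψ
      = expectation ψ C • ψ := by
    intro C
    rw [sum_mulVec, Finset.sum_eq_single k]
    · rw [hP, vecMulVec_mul_mul_vecMulVec, smul_mulVec, ← hP, hv, if_pos rfl]
    · intro i _ hi
      rw [← mulVec_mulVec, hv, if_neg hi, mulVec_zero]
    · simp
  have hψ' : star ψ ⬝ᵥ ψ = 1 := hψ
  unfold expectation at *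
  rw [← mulVec_mulVec, h, mulVec_smul, h, dotProduct_smul, dotProduct_smul, hψ']
  simp [mul_comm]

/-- Acting to the left on `ψ`, the first spectral projection survives only at the index of `ψ`, so
the double sum over energies collapses to a single one. -/
theorem expectation_heisenberg_of_isEigen {S : Type*} [Fintype S] [DecidableEq S] {q : ℕ}
    {G : Op S q} (hG : G.IsHermitian) (hinj : Function.Injective hG.eigenvalues)
    {ψ : Conf S q → ℂ} (hψ : IsUnitVector ψ) {E : ℝ} (hE : G.mulVec ψ = (E : ℂ) • ψ) (t : ℝ)
    (A B : Op S q) : expectation ψ (heisenberg G t A * B) =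
      ∑ j, Complex.exp (Complex.I * ((E - hG.eigenvalues j : ℝ) : ℂ) * t) •
        expectation ψ (A * hG.eigenProj j * B) := by
  obtain ⟨k, hk, -, hv⟩ := exists_eigenProj_eq hG hinj hψ hE
  have hl : ∀ i (M : Op S q), expectation ψ (hG.eigenProj i * M) =
      if i = k then expectation ψ M else 0 := by
    intro i M
    have h := congrArg star (hv i)
    rw [star_mulVec, (hG.isHermitian_eigenProj i).eq] at h
    unfold expectation
    rw [← mulVec_mulVec, dotProduct_mulVec, h]
    split_ifs <;> simp
  rw [heisenberg_eq_sum hG]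
  simp only [← expectationLin_apply, Finset.sum_mul, smul_mul_assoc, map_sum, map_smul, mul_assoc]
  simp only [expectationLin_apply, hl]
  rw [Finset.sum_eq_single k]
  · simp [hk]
  · intro i _ hi; simp [hi]
  · simp

end TimeMean

end SpinLattice

/-! ### Clustering from strong dynamical localisation -/

namespace SpinLattice

open Matrix Filter Topology

section Expectation

variable {S : Type*} [Fintype S] [DecidableEq S] {q : ℕ}

theorem expectation_sub (ψ : Conf S q → ℂ) (A B : Op S q) :
    expectation ψ (A - B) = expectation ψ A - expectation ψ B :=
  map_sub (expectationLin ψ) A B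

theorem norm_mul_sub_mul_le {F : Type*} [NormedRing F] {A A' B B' : F} {δ : ℝ}
    (hA : ‖A - A'‖ ≤ δ) (hB : ‖B - B'‖ ≤ δ) (hA' : ‖A'‖ ≤ 1) (hB₁ : ‖B‖ ≤ 1) :
    ‖A * B - A' * B'‖ ≤ 2 * δ := by
  have h : A * B - A' * B' = (A - A') * B + A' * (B - B') := by noncomm_ring
  rw [h]
  have hδ : 0 ≤ δ := (norm_nonneg _).trans hA
  calc _ ≤ ‖(A - A') * B‖ + ‖A' * (B - B')‖ := norm_add_le _ _
    _ ≤ ‖A - A'‖ * ‖B‖ + ‖A'‖ * ‖B - B'‖ := add_le_add (norm_mul_le _ _) (norm_mul_le _ _)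
    _ ≤ δ * 1 + 1 * δ := by gcongr
    _ = 2 * δ := by ring

theorem expectation_heisenberg {G : Op S q} (hG : G.IsHermitian)
    (hinj : Function.Injective hG.eigenvalues) {ψ : Conf S q → ℂ} (hψ : IsUnitVector ψ) {E : ℝ}
    (hE : G.mulVec ψ = (E : ℂ) • ψ) (t : ℝ) (A : Op S q) :
    expectation ψ (heisenberg G t A) = expectation ψ A := by
  have h := expectation_heisenberg_of_isEigen hG hinj hψ hE t A 1
  obtain ⟨k, hk, -, hv⟩ := exists_eigenProj_eq hG hinj hψ hE
  have hz : ∀ j, expectation ψ (A * hG.eigenProj j) = if j = k then expectation ψ A else 0 := by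
    intro j
    unfold expectation
    rw [← mulVec_mulVec, hv]
    split_ifs <;> simp
  simp only [mul_one, hz] at h
  rw [h, Finset.sum_eq_single k]
  · simp [hk]
  · intro j _ hj; simp [hj]
  · simp

end Expectation

namespace LocalHamiltonian

section Distance

variable {V ι : Type*} {q : ℕ} (H : LocalHamiltonian V ι q)

theorem dist_comm (X Y : Finset V) : H.dist X Y = H.dist Y X := by
  unfold dist
  rw [iInf₂_comm]
  simp only [SimpleGraph.edist_comm]

theorem one_le_dist {X Y : Finset V} (h : Disjoint X Y) : 1 ≤ H.dist X Y := by
  refine le_iInf₂ fun x hx => le_iInf₂ fun y hy => ?_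
  rw [Order.one_le_iff_ne_zero, Ne, SimpleGraph.edist_eq_zero_iff]
  rintro rfl
  exact Finset.disjoint_left.1 h hx hy

variable [Fintype V]

theorem subset_halfway {X Y : Finset V} (h : Disjoint X Y) : X ⊆ H.halfway X Y := by
  intro x hx
  unfold halfway
  simp only [Finset.mem_filter, Finset.mem_univ, true_and]
  refine ⟨x, hx, ?_⟩
  rw [SimpleGraph.edist_self, mul_zero]
  exact lt_of_lt_of_le zero_lt_one (H.one_le_dist h)

variable [DecidableEq V]

/-- Distances are integers: `2 d(y, x) < n` is the same as `2 d(y, x) ≤ n - 1`, so the region is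
constant for `l` in `[(n - 1)/2, n/2)`. -/
theorem nbhd_eq_halfway_of_finite {X Y : Finset V} {n : ℕ} (hn : H.dist X Y = n) {l : ℝ}
    (h1 : (n - 1 : ℝ) / 2 ≤ l) (h2 : l < (n : ℝ) / 2) : H.nbhd X l = H.halfway X Y := by
  ext x
  unfold nbhd halfway
  simp only [Finset.mem_filter, Finset.mem_univ, true_and, hn]
  refine exists_congr fun y => and_congr_right fun _ => ⟨fun ⟨hr, hl⟩ => ?_, fun hl => ?_⟩
  · rw [← hr.coe_dist_eq_edist]
    have : (2 * H.interactionGraph.dist y x : ℝ) < n := by linarith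
    exact_mod_cast this
  · have hr : H.interactionGraph.Reachable y x := by
      rw [← SimpleGraph.edist_ne_top_iff_reachable]
      intro ht
      rw [ht] at hl
      simp at hl
    refine ⟨hr, ?_⟩
    rw [← hr.coe_dist_eq_edist] at hl
    have h3 : 2 * H.interactionGraph.dist y x < n := by exact_mod_cast hl
    have h4 : (2 * H.interactionGraph.dist y x + 1 : ℝ) ≤ n := by exact_mod_cast h3
    linarith

/-- There are finitely many sites, so a large `l` leaves only reachability from `X`, which is also
what `2 * edist < ⊤` says. -/
theorem eventually_nbhd_eq_halfway {X Y : Finset V} (hn : H.dist X Y = ⊤) :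
    ∀ᶠ l : ℝ in atTop, H.nbhd X l = H.halfway X Y := by
  have h : ∀ᶠ l : ℝ in atTop, ∀ y x, (H.interactionGraph.dist y x : ℝ) ≤ l :=
    eventually_all.2 fun y => eventually_all.2 fun x => eventually_ge_atTop _
  filter_upwards [h] with l hl
  ext x
  unfold nbhd halfway
  simp only [Finset.mem_filter, Finset.mem_univ, true_and, hn, hl, and_true]
  refine exists_congr fun y => and_congr_right fun _ => ?_
  rw [← SimpleGraph.edist_ne_top_iff_reachable, lt_top_iff_ne_top]
  refine not_congr ⟨fun h => by simp [h], fun h => ?_⟩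
  by_contra h'
  obtain ⟨k, hk⟩ := ENat.ne_top_iff_exists.1 h'
  rw [← hk] at h
  exact ENat.natCast_ne_top (2 * k) (by exact_mod_cast h)

end Distance

variable {V ι : Type*} [Fintype V] [DecidableEq V] [Fintype ι] {q : ℕ}
variable (H : LocalHamiltonian V ι q)

theorem norm_correlation_le_of_local {X Y R R' : Finset V} {A B : Op V q} {δ : ℝ}
    (hnd : H.NondegenerateEnergies) (hgap : H.LocallyIndependentGaps R R')
    (hX : X ⊆ R) (hY : Y ⊆ R') (hA : IsObservableOn X A) (hB : IsObservableOn Y B)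
    (hAδ : ∀ t : ℝ, 0 ≤ t → ‖heisenberg H.full t A - heisenberg (H.trunc R) t A‖ ≤ δ)
    (hBδ : ∀ t : ℝ, 0 ≤ t → ‖heisenberg H.full t B - heisenberg (H.trunc R') t B‖ ≤ δ)
    {ψ : Conf V q → ℂ} {E : ℝ} (hψ : IsUnitVector ψ) (hE : H.IsEigen ψ E) :
    ‖expectation ψ (A * B) - expectation ψ A * expectation ψ B‖ ≤ 4 * δ := by
  have hG := H.full_isHermitian
  have hR := H.region_isHermitian R
  have hR' := H.region_isHermitian R'
  obtain ⟨a, ha⟩ := hA.exists_embedHom R hX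
  obtain ⟨b, hb⟩ := hB.exists_embedHom R' hY
  have mean_full : ∀ C : Op V q, HasTimeMean (fun t => heisenberg H.full t C)
      (∑ i, hG.eigenProj i * C * hG.eigenProj i) := by
    intro C
    simp only [heisenberg_eq_sum hG]
    exact hasTimeMean_gaps hnd fun i j => hG.eigenProj i * C * hG.eigenProj j
  have mean_A : HasTimeMean (fun t => heisenberg (H.trunc R) t A)
      (∑ i, embedHom R (hR.eigenProj i * a * hR.eigenProj i)) := by
    simp only [ha, H.trunc_eq_embedHom, heisenberg_embedHom_eq_sum R hR]
    exact hasTimeMean_gaps hgap.1 fun i j => embedHom R (hR.eigenProj i * a * hR.eigenProj j)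
  have mean_B : HasTimeMean (fun t => heisenberg (H.trunc R') t B)
      (∑ i, embedHom R' (hR'.eigenProj i * b * hR'.eigenProj i)) := by
    simp only [hb, H.trunc_eq_embedHom, heisenberg_embedHom_eq_sum R' hR']
    exact hasTimeMean_gaps hgap.2.1 fun i j => embedHom R' (hR'.eigenProj i * b * hR'.eigenProj j)
  have mean_AB : HasTimeMean (fun t => heisenberg (H.trunc R) t A * heisenberg (H.trunc R') t B)
      ((∑ i, embedHom R (hR.eigenProj i * a * hR.eigenProj i)) *
        ∑ i, embedHom R' (hR'.eigenProj i * b * hR'.eigenProj i)) := by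
    simp only [ha, hb, H.trunc_eq_embedHom, heisenberg_embedHom_eq_sum R hR,
      heisenberg_embedHom_eq_sum R' hR']
    exact hasTimeMean_gaps_mul hgap.2.2
      (fun i j => embedHom R (hR.eigenProj i * a * hR.eigenProj j))
      (fun i j => embedHom R' (hR'.eigenProj i * b * hR'.eigenProj j))
  set MA := ∑ i, embedHom R (hR.eigenProj i * a * hR.eigenProj i)
  set MB := ∑ i, embedHom R' (hR'.eigenProj i * b * hR'.eigenProj i)
  have norm_A : ∀ t, ‖heisenberg (H.trunc R) t A‖ ≤ 1 := fun t => by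
    rw [norm_heisenberg (H.isHermitian_trunc R), hA.2.2]
  have norm_B : ∀ t, ‖heisenberg H.full t B‖ ≤ 1 := fun t => by
    rw [norm_heisenberg hG, hB.2.2]
  -- The expectation of `A(t) B(t)` does not depend on `t`; it is compared with the truncated
  -- product at each time and then averaged.
  have first : ‖expectation ψ (A * B) - expectation ψ (MA * MB)‖ ≤ 2 * δ := by
    rw [← expectation_sub]
    refine (le_of_eq ?_).trans (HasTimeMean.norm_le (f := fun t => expectation ψ
      (heisenberg H.full t A * heisenberg H.full t B -
        heisenberg (H.trunc R) t A * heisenberg (H.trunc R') t B))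
      (m := expectation ψ (A * B - MA * MB)) ?_ (C := 2 * δ) fun t ht => ?_)
    · rfl
    · have h1 := (HasTimeMean.const (expectation ψ (A * B)))
      have h2 : HasTimeMean (fun t => expectation ψ
          (heisenberg (H.trunc R) t A * heisenberg (H.trunc R') t B)) (expectation ψ (MA * MB)) :=
        mean_AB.clm ((expectationLin ψ).toContinuousLinearMap.restrictScalars ℝ)
      rw [expectation_sub]
      refine (h1.sub h2).congr fun t => ?_
      rw [expectation_sub, heisenberg_mul hG, expectation_heisenberg hG hnd hψ hE]
    · exact (norm_expectation_le hψ _).trans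
        (norm_mul_sub_mul_le (hAδ t ht) (hBδ t ht) (norm_A t) (norm_B t))
  -- Here the averages are taken before multiplying: `MA` and `MB` are within `δ` of the dephased
  -- `A` and `B`.
  have second : ‖expectation ψ (MA * MB) - expectation ψ A * expectation ψ B‖ ≤ 2 * δ := by
    rw [norm_sub_rev, ← expectation_dephase_mul hG hnd hψ hE, ← expectation_sub]
    refine (norm_expectation_le hψ _).trans (norm_mul_sub_mul_le ?_ ?_ ?_ ?_)
    · exact ((mean_full A).sub mean_A).norm_le hAδ
    · exact ((mean_full B).sub mean_B).norm_le hBδ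
    · exact mean_A.norm_le fun t _ => norm_A t
    · exact (mean_full B).norm_le fun t _ => norm_B t
  calc _ ≤ _ := norm_sub_le_norm_sub_add_norm_sub _ (expectation ψ (MA * MB)) _
    _ ≤ 2 * δ + 2 * δ := add_le_add first second
    _ = 4 * δ := by ring

theorem norm_correlation_le_of_localised {c μ : ℝ} (hloc : H.StrongDynamicalLocalisation c μ)
    (hnd : H.NondegenerateEnergies) {X Y : Finset V} (hXY : Disjoint X Y)
    (hgap : H.LocallyIndependentGaps (H.halfway X Y) (H.halfway Y X)) {A B : Op V q}
    (hA : IsObservableOn X A) (hB : IsObservableOn Y B) {ψ : Conf V q → ℂ} {E : ℝ}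
    (hψ : IsUnitVector ψ) (hE : H.IsEigen ψ E) :
    ‖expectation ψ (A * B) - expectation ψ A * expectation ψ B‖
      ≤ 4 * c * expDecay (μ / 2) (H.dist X Y) := by
  obtain ⟨hc, hμ, hl⟩ := hloc
  have key : ∀ l : ℝ, 0 ≤ l → H.nbhd X l = H.halfway X Y → H.nbhd Y l = H.halfway Y X →
      ‖expectation ψ (A * B) - expectation ψ A * expectation ψ B‖
        ≤ 4 * (c * Real.exp (-μ * l)) := by
    intro l hl0 hX hY
    refine H.norm_correlation_le_of_local hnd hgap (H.subset_halfway hXY)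
      (H.subset_halfway hXY.symm) hA hB ?_ ?_ hψ hE
    · rw [← hX]; exact hl X A hA l hl0
    · rw [← hY]; exact hl Y B hB l hl0
  unfold expDecay
  split_ifs with ht
  -- At infinite distance `l` is arbitrary and the bound tends to `0`.
  · have hlim : Tendsto (fun l : ℝ => 4 * (c * Real.exp (-μ * l))) atTop (𝓝 (4 * c * 0)) := by
      rw [mul_assoc]
      refine ((Real.tendsto_exp_atBot.comp ?_).const_mul c).const_mul 4
      exact tendsto_id.const_mul_atTop_of_neg (by linarith)
    refine ge_of_tendsto hlim ?_
    filter_upwards [eventually_ge_atTop 0, H.eventually_nbhd_eq_halfway ht,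
      H.eventually_nbhd_eq_halfway ((H.dist_comm Y X).trans ht)] with l h0 h1 h2
    exact key l h0 h1 h2
  · obtain ⟨n, hn⟩ := ENat.ne_top_iff_exists.1 ht
    have hn1 : (1 : ℝ) ≤ n := by
      have := H.one_le_dist hXY
      rw [← hn] at this
      exact_mod_cast this
    -- At `l = d/2` itself the neighbourhood may exceed the halfway region, so that value is reached
    -- only as a limit from below.
    have hlim : Tendsto (fun l : ℝ => 4 * (c * Real.exp (-μ * l))) (𝓝[<] ((n : ℝ) / 2))
        (𝓝 (4 * (c * Real.exp (-μ * ((n : ℝ) / 2))))) :=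
      (Continuous.tendsto (by fun_prop) _).mono_left nhdsWithin_le_nhds
    have hb : ‖expectation ψ (A * B) - expectation ψ A * expectation ψ B‖ ≤
        4 * (c * Real.exp (-μ * ((n : ℝ) / 2))) := by
      refine ge_of_tendsto hlim ?_
      filter_upwards [Ico_mem_nhdsLT (show ((n : ℝ) - 1) / 2 < n / 2 by linarith)] with l hl'
      exact key l (by linarith [hl'.1]) (H.nbhd_eq_halfway_of_finite hn.symm hl'.1 hl'.2)
        (H.nbhd_eq_halfway_of_finite ((H.dist_comm Y X).trans hn.symm) hl'.1 hl'.2)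
    refine hb.trans (le_of_eq ?_)
    rw [← hn, ENat.toNat_natCast, mul_assoc]
    congr 3
    ring

end LocalHamiltonian

end SpinLattice

/-! ### The Gaussian-smoothed sign function -/

section GaussianFilter

open MeasureTheory Filter Topology Real

/-- The sign function smoothed by a Gaussian of variance `2 α`: the error function of
`ω / (2 √α)`. -/
noncomputable def smoothSign (α ω : ℝ) : ℝ :=
  ∫ s in (0 : ℝ)..ω, rexp (-(4 * α)⁻¹ * s ^ 2) / √(π * α)

theorem smoothSign_zero (α : ℝ) : smoothSign α 0 = 0 := by simp [smoothSign]

theorem smoothSign_neg (α ω : ℝ) : smoothSign α (-ω) = -smoothSign α ω := by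
  unfold smoothSign
  have h := intervalIntegral.integral_comp_neg (a := 0) (b := ω)
    (f := fun s : ℝ => rexp (-(4 * α)⁻¹ * s ^ 2) / √(π * α))
  simp only [neg_sq, neg_zero] at h
  rw [h, intervalIntegral.integral_symm]

section

variable {α : ℝ}

theorem integral_Ioi_gaussian_div (hα : 0 < α) :
    ∫ s in Set.Ioi (0 : ℝ), rexp (-(4 * α)⁻¹ * s ^ 2) / √(π * α) = 1 := by
  rw [integral_div, integral_gaussian_Ioi, div_inv_eq_mul,
    show π * (4 * α) = 2 ^ 2 * (π * α) by ring, sqrt_mul (by positivity), sqrt_sq (by norm_num)]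
  have : 0 < √(π * α) := sqrt_pos.2 (by positivity)
  field_simp

theorem integrable_gaussian_div (hα : 0 < α) :
    Integrable fun s : ℝ => rexp (-(4 * α)⁻¹ * s ^ 2) / √(π * α) :=
  (integrable_exp_neg_mul_sq (by positivity)).div_const _

theorem one_sub_smoothSign (hα : 0 < α) (ω : ℝ) :
    1 - smoothSign α ω = ∫ s in Set.Ioi ω, rexp (-(4 * α)⁻¹ * s ^ 2) / √(π * α) := by
  have h := intervalIntegral.integral_interval_add_Ioi
    (integrable_gaussian_div hα).integrableOn (integrable_gaussian_div hα).integrableOn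
    (a := 0) (b := ω) (μ := volume)
  rw [integral_Ioi_gaussian_div hα] at h
  rw [← h]
  unfold smoothSign
  ring

theorem one_sub_smoothSign_nonneg (hα : 0 < α) (ω : ℝ) : 0 ≤ 1 - smoothSign α ω := by
  rw [one_sub_smoothSign hα]
  exact integral_nonneg fun s => by positivity

/-- Shift the tail to start at `0` and use `(s + ω)² ≥ s² + ω²` for `s, ω ≥ 0`; the remaining
half-line integral is `1`. -/
theorem one_sub_smoothSign_le (hα : 0 < α) {ω : ℝ} (hω : 0 ≤ ω) :
    1 - smoothSign α ω ≤ rexp (-(4 * α)⁻¹ * ω ^ 2) := by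
  rw [one_sub_smoothSign hα]
  have h := (measurePreserving_add_right volume ω).setIntegral_preimage_emb
    (measurableEmbedding_addRight ω)
    (fun s : ℝ => rexp (-(4 * α)⁻¹ * s ^ 2) / √(π * α)) (Set.Ioi ω)
  rw [Set.preimage_add_const_Ioi, sub_self] at h
  rw [← h]
  calc ∫ s in Set.Ioi (0 : ℝ), rexp (-(4 * α)⁻¹ * (s + ω) ^ 2) / √(π * α)
      ≤ ∫ s in Set.Ioi (0 : ℝ), rexp (-(4 * α)⁻¹ * ω ^ 2) *
          (rexp (-(4 * α)⁻¹ * s ^ 2) / √(π * α)) := by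
        refine setIntegral_mono_on
          (((integrable_gaussian_div hα).comp_add_right ω).integrableOn)
          ((integrable_gaussian_div hα).const_mul _).integrableOn measurableSet_Ioi fun s hs => ?_
        rw [← mul_div_assoc, ← Real.exp_add]
        have hs' : 0 < s := hs
        have h4 : 0 < (4 * α)⁻¹ := by positivity
        have h5 : 0 ≤ (4 * α)⁻¹ * (s * ω) := by positivity
        gcongr
        nlinarith
    _ = _ := by rw [integral_const_mul, integral_Ioi_gaussian_div hα, mul_one]

theorem abs_smoothSign_le_one (hα : 0 < α) (ω : ℝ) : |smoothSign α ω| ≤ 1 := by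
  have h1 := one_sub_smoothSign_nonneg hα ω
  have h2 := one_sub_smoothSign_nonneg hα (-ω)
  rw [smoothSign_neg] at h2
  exact abs_le.2 ⟨by linarith, by linarith⟩

theorem integral_Ioi_cos_mul_gaussian (hα : 0 < α) (ω : ℝ) :
    ∫ t in Set.Ioi (0 : ℝ), cos (ω * t) * rexp (-α * t ^ 2) =
      π / 2 * (rexp (-(4 * α)⁻¹ * ω ^ 2) / √(π * α)) := by
  have h := fourierIntegral_gaussian (b := α) (by simpa using hα) ω
  have h1 : ∫ t : ℝ, cos (ω * t) * rexp (-α * t ^ 2) = √(π / α) * rexp (-(4 * α)⁻¹ * ω ^ 2) := by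
    have hre := congrArg Complex.re h
    have hint : Integrable fun x : ℝ =>
        Complex.exp (Complex.I * ω * x) * Complex.exp (-(α : ℂ) * x ^ 2) := by
      refine (integrable_exp_neg_mul_sq hα).mono' (by fun_prop) (ae_of_all _ fun x => ?_)
      rw [norm_mul, Complex.norm_exp, Complex.norm_exp]
      simp [← Complex.ofReal_pow]
    rw [← RCLike.re_eq_complex_re, ← integral_re hint] at hre
    simp only [RCLike.re_eq_complex_re] at hre
    convert hre using 1
    · congr 1
      ext x
      rw [show Complex.I * (ω : ℂ) * x = ((ω * x : ℝ) : ℂ) * Complex.I by push_cast; ring,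
        show (-(α : ℂ) * x ^ 2) = ((-α * x ^ 2 : ℝ) : ℂ) by push_cast; ring,
        ← Complex.ofReal_exp, Complex.re_mul_ofReal, Complex.exp_ofReal_mul_I_re]
    · rw [show -(ω : ℂ) ^ 2 / (4 * α) = ((-(4 * α)⁻¹ * ω ^ 2 : ℝ) : ℂ) by
        push_cast; field_simp, ← Complex.ofReal_exp, Complex.re_mul_ofReal, sqrt_eq_rpow,
        ← Complex.ofReal_div, show (1 / 2 : ℂ) = ((1 / 2 : ℝ) : ℂ) by push_cast; rfl,
        ← Complex.ofReal_cpow (by positivity), Complex.ofReal_re]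
  have h2 := integral_comp_abs (f := fun t => cos (ω * t) * rexp (-α * t ^ 2))
  have h3 : ∀ t : ℝ, cos (ω * |t|) * rexp (-α * |t| ^ 2) = cos (ω * t) * rexp (-α * t ^ 2) := by
    intro t
    rw [sq_abs, ← cos_abs (ω * |t|), abs_mul, abs_abs, ← abs_mul, cos_abs]
  simp only [h3] at h2
  rw [h1] at h2
  have h4 : √(π / α) = π / √(π * α) := by
    rw [sqrt_div pi_pos.le, sqrt_mul pi_pos.le]
    have := sqrt_pos.2 hα
    have := sqrt_pos.2 pi_pos
    field_simp
    rw [sq_sqrt pi_pos.le]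
  rw [h4] at h2
  linear_combination -h2 / 2

theorem norm_sin_div_mul_gaussian_le (ω t : ℝ) (α : ℝ) :
    ‖sin (ω * t) / t * rexp (-α * t ^ 2)‖ ≤ |ω| * rexp (-α * t ^ 2) := by
  rw [norm_mul, norm_of_nonneg (Real.exp_pos _).le, norm_div, Real.norm_eq_abs, Real.norm_eq_abs]
  gcongr
  by_cases ht : t = 0
  · simp [ht]
  · rw [div_le_iff₀ (abs_pos.2 ht), ← abs_mul]
    exact abs_sin_le_abs

theorem integrable_sin_div_mul_gaussian (hα : 0 < α) (ω : ℝ) :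
    Integrable fun t : ℝ => sin (ω * t) / t * rexp (-α * t ^ 2) :=
  ((integrable_exp_neg_mul_sq hα).const_mul |ω|).mono'
    (by fun_prop) (ae_of_all _ fun t => norm_sin_div_mul_gaussian_le ω t α)

/-- Both sides vanish at `ω = 0`. Differentiating in `ω` removes the `1/t` and leaves the Gaussian
cosine transform. -/
theorem integral_Ioi_sin_div_mul_gaussian (hα : 0 < α) (ω : ℝ) :
    ∫ t in Set.Ioi (0 : ℝ), sin (ω * t) / t * rexp (-α * t ^ 2) = π / 2 * smoothSign α ω := by
  set Φ : ℝ → ℝ := fun ω => ∫ t in Set.Ioi (0 : ℝ), sin (ω * t) / t * rexp (-α * t ^ 2)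
  have hΦ : ∀ ω, HasDerivAt Φ (π / 2 * (rexp (-(4 * α)⁻¹ * ω ^ 2) / √(π * α))) ω := by
    intro ω
    rw [← integral_Ioi_cos_mul_gaussian hα]
    refine (hasDerivAt_integral_of_dominated_loc_of_deriv_le
      (F := fun ω t => sin (ω * t) / t * rexp (-α * t ^ 2))
      (F' := fun ω t => cos (ω * t) * rexp (-α * t ^ 2))
      (bound := fun t => rexp (-α * t ^ 2)) univ_mem
      (Eventually.of_forall fun x => (integrable_sin_div_mul_gaussian hα x).1.restrict)
      (integrable_sin_div_mul_gaussian hα ω).integrableOn (by fun_prop) ?_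
      (integrable_exp_neg_mul_sq hα).integrableOn ?_).2
    · refine ae_of_all _ fun t x _ => ?_
      rw [norm_mul, norm_of_nonneg (Real.exp_pos _).le]
      exact mul_le_of_le_one_left (Real.exp_pos _).le (abs_cos_le_one _)
    · refine (ae_restrict_iff' measurableSet_Ioi).2 (ae_of_all _ fun t ht x _ => ?_)
      have ht' : t ≠ 0 := (ne_of_gt ht)
      have h := ((((hasDerivAt_id x).mul_const t).sin).div_const t).mul_const (rexp (-α * t ^ 2))
      refine h.congr_deriv ?_
      simp only [id]
      field_simp
  have hc : Continuous fun ω : ℝ => π / 2 * (rexp (-(4 * α)⁻¹ * ω ^ 2) / √(π * α)) := by fun_prop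
  have h := intervalIntegral.integral_eq_sub_of_hasDerivAt (a := 0) (b := ω)
    (fun x _ => hΦ x) (hc.intervalIntegrable _ _)
  rw [intervalIntegral.integral_const_mul] at h
  have h0 : Φ 0 = 0 := by simp [Φ]
  rw [h0, sub_zero] at h
  exact h.symm

theorem integral_Ioi_mul_exp_neg_mul_sq (hα : 0 < α) (T : ℝ) :
    IntegrableOn (fun t => t * rexp (-α * t ^ 2)) (Set.Ioi T) ∧
      ∫ t in Set.Ioi T, t * rexp (-α * t ^ 2) = rexp (-α * T ^ 2) / (2 * α) := by
  have hi : Integrable fun t : ℝ => t * rexp (-α * t ^ 2) := integrable_mul_exp_neg_mul_sq hα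
  refine ⟨hi.integrableOn, ?_⟩
  have hd : ∀ t : ℝ, HasDerivAt (fun t => -rexp (-α * t ^ 2) / (2 * α)) (t * rexp (-α * t ^ 2)) t := by
    intro t
    have h := ((((hasDerivAt_pow 2 t).const_mul (-α)).exp).neg).div_const (2 * α)
    refine h.congr_deriv ?_
    simp only [Nat.cast_ofNat, Nat.add_one_sub_one, pow_one]
    field_simp
  have hlim : Tendsto (fun t : ℝ => -rexp (-α * t ^ 2) / (2 * α)) atTop (𝓝 (-0 / (2 * α))) := by
    refine ((Real.tendsto_exp_atBot.comp ?_).neg).div_const _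
    exact (tendsto_pow_atTop two_ne_zero).const_mul_atTop_of_neg (by linarith)
  rw [integral_Ioi_of_hasDerivAt_of_tendsto' (fun t _ => hd t) hi.integrableOn hlim]
  ring

/-- A function bounded by `η min(t, 1)` integrated against `e^{-α t²} / t`. -/
theorem abs_integral_div_mul_gaussian_le (hα : 0 < α) {g : ℝ → ℝ} {η : ℝ} (hη : 0 ≤ η)
    (hint : IntegrableOn (fun t => g t / t * rexp (-α * t ^ 2)) (Set.Ioi 0))
    (hg : ∀ t, 0 ≤ t → |g t| ≤ min t 1 * η) :
    |∫ t in Set.Ioi (0 : ℝ), g t / t * rexp (-α * t ^ 2)| ≤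
      η * (3 / 2 + log (max 1 α⁻¹) / 2) := by
  set f : ℝ → ℝ := fun t => g t / t * rexp (-α * t ^ 2)
  -- The integral is cut at `1`, where `min t 1` changes form, and at `T`, beyond which `α t² ≥ 1`.
  -- The three pieces give `η`, `η log T` and `η/2`.
  set T := √(max 1 α⁻¹) with hT
  have hm : 0 < max 1 α⁻¹ := lt_of_lt_of_le one_pos (le_max_left _ _)
  have hT1 : 1 ≤ T := by
    rw [hT, one_le_sqrt]; exact le_max_left _ _
  have hT2 : 1 ≤ α * T ^ 2 := by
    rw [hT, sq_sqrt hm.le]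
    calc 1 = α * α⁻¹ := (mul_inv_cancel₀ hα.ne').symm
      _ ≤ _ := by gcongr; exact le_max_right _ _
  have hlog : log T = log (max 1 α⁻¹) / 2 := by rw [hT, log_sqrt hm.le]
  have hf : ∀ t, 0 < t → ‖f t‖ ≤ η * (min t 1 / t * rexp (-α * t ^ 2)) := by
    intro t ht
    simp only [f]
    rw [norm_mul, norm_div, norm_of_nonneg (Real.exp_pos _).le, norm_of_nonneg ht.le,
      Real.norm_eq_abs, ← mul_assoc, mul_div_assoc', mul_comm η]
    gcongr
    exact hg t ht.le
  have he : ∀ t : ℝ, rexp (-α * t ^ 2) ≤ 1 := fun t =>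
    Real.exp_le_one_iff.2 (by nlinarith [sq_nonneg t])
  have hi : ∀ a b : ℝ, 0 ≤ a → a ≤ b → IntervalIntegrable f volume a b := fun a b ha hab =>
    (intervalIntegrable_iff_integrableOn_Ioc_of_le hab).2
      (hint.mono_set fun x hx => lt_of_le_of_lt ha hx.1)
  have hsplit : ∫ t in Set.Ioi (0 : ℝ), f t =
      (∫ t in (0 : ℝ)..1, f t) + (∫ t in (1 : ℝ)..T, f t) + ∫ t in Set.Ioi T, f t := by
    rw [intervalIntegral.integral_add_adjacent_intervals (hi 0 1 le_rfl zero_le_one)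
      (hi 1 T zero_le_one hT1), intervalIntegral.integral_interval_add_Ioi hint
      (hint.mono_set (Set.Ioi_subset_Ioi (by linarith)))]
  have b1 : ‖∫ t in (0 : ℝ)..1, f t‖ ≤ η := by
    have := intervalIntegral.norm_integral_le_of_norm_le_const (a := 0) (b := 1) (C := η) (f := f)
      fun t ht => ?_
    · simpa using this
    · rw [Set.uIoc_of_le zero_le_one] at ht
      refine (hf t ht.1).trans (mul_le_of_le_one_right hη ?_)
      rw [min_eq_left ht.2, div_self ht.1.ne', one_mul]
      exact he t
  have b2 : ‖∫ t in (1 : ℝ)..T, f t‖ ≤ η * log T := by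
    have h0 : (0 : ℝ) ∉ Set.uIcc 1 T := by
      rw [Set.uIcc_of_le hT1]; exact fun h => absurd h.1 (by norm_num)
    have h1 : ∫ t in (1 : ℝ)..T, η * (1 / t) = η * log T := by
      rw [intervalIntegral.integral_const_mul, integral_one_div h0, div_one]
    rw [← h1]
    refine intervalIntegral.norm_integral_le_of_norm_le hT1 (ae_of_all _ fun t ht => ?_)
      ((intervalIntegral.intervalIntegrable_one_div
        (fun x hx => fun h => h0 (h ▸ hx)) continuousOn_id).const_mul η)
    have ht0 : 0 < t := one_pos.trans ht.1
    refine (hf t ht0).trans ?_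
    rw [min_eq_right ht.1.le]
    gcongr
    exact mul_le_of_le_one_right (by positivity) (he t)
  -- On the tail `1/t ≤ α t`, which makes the integrand explicitly integrable.
  have b3 : ‖∫ t in Set.Ioi T, f t‖ ≤ η * (1 / 2) := by
    obtain ⟨hi1, hi2⟩ := integral_Ioi_mul_exp_neg_mul_sq hα T
    have h1 : ∫ t in Set.Ioi T, η * α * (t * rexp (-α * t ^ 2)) ≤ η * (1 / 2) := by
      rw [integral_const_mul, hi2]
      calc η * α * (rexp (-α * T ^ 2) / (2 * α)) = η * (1 / 2) * rexp (-α * T ^ 2) := by field_simp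
        _ ≤ η * (1 / 2) := mul_le_of_le_one_right (by positivity) (he T)
    refine le_trans ?_ h1
    refine norm_integral_le_of_norm_le (hi1.const_mul _)
      ((ae_restrict_iff' measurableSet_Ioi).2 (ae_of_all _ fun t ht => ?_))
    have ht' : T < t := ht
    have ht0 : 0 < t := by linarith
    refine (hf t ht0).trans ?_
    rw [min_eq_right (hT1.trans ht'.le), mul_assoc, ← mul_assoc α]
    gcongr
    rw [div_le_iff₀ ht0]
    nlinarith [mul_le_mul ht'.le ht'.le (by linarith) ht0.le]
  rw [hsplit, ← Real.norm_eq_abs]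
  calc _ ≤ _ := norm_add₃_le
    _ ≤ η + η * log T + η * (1 / 2) := by gcongr
    _ = _ := by rw [hlog]; ring

end

end GaussianFilter

/-! ### Filtering trigonometric sums -/

section Filter

variable {n : Type*} [Fintype n] {ν : n → ℝ} {C : n → ℂ} {ε : ℝ}

/-- The coefficients of a bounded trigonometric sum `F - conj F` are bounded. -/
theorem norm_coeff_le_of_norm_sub_conj_le
    (hF : ∀ t : ℝ, 0 ≤ t → ‖(∑ j, Complex.exp (Complex.I * (ν j : ℂ) * t) • C j) -
      star (∑ j, Complex.exp (Complex.I * (ν j : ℂ) * t) • C j)‖ ≤ ε)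
    {s : n} (hs : ∀ r, r ≠ s → |ν r| ≠ |ν s|) (hs0 : ν s ≠ 0) : ‖C s‖ ≤ ε := by
  classical
  -- After multiplication by `e^{-i ν_s t}` only `C s` is stationary: a conjugate term would need `ν
  -- j = -ν s`, which is excluded.
  have h1 : HasTimeMean (fun t : ℝ =>
      (∑ j, Complex.exp (Complex.I * ((ν j - ν s : ℝ) : ℂ) * t) • C j) -
      ∑ j, Complex.exp (Complex.I * ((-ν j - ν s : ℝ) : ℂ) * t) • star (C j))
      ((∑ j, if ν j - ν s = 0 then C j else 0) -
        ∑ j, if -ν j - ν s = 0 then star (C j) else 0) :=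
    (HasTimeMean.sum fun j _ => hasTimeMean_exp_smul _ _).sub
      (HasTimeMean.sum fun j _ => hasTimeMean_exp_smul _ _)
  have h2 : ((∑ j, if ν j - ν s = 0 then C j else 0) -
      ∑ j, if -ν j - ν s = 0 then star (C j) else 0) = C s := by
    rw [Finset.sum_eq_single s, Finset.sum_eq_zero, if_pos (sub_self _), sub_zero]
    · intro j _
      rw [if_neg]
      intro h
      have h' : ν j = -ν s := by linarith
      by_cases hj : j = s
      · subst hj; exact hs0 (by linarith)
      · exact hs j hj (by rw [h', abs_neg])
    · intro j _ hj
      rw [if_neg]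
      intro h
      exact hs j hj (by rw [sub_eq_zero.1 h])
    · simp
  rw [h2] at h1
  refine h1.norm_le fun t ht => le_trans (le_of_eq ?_) (hF t ht)
  have h3 : ‖Complex.exp (Complex.I * ((-ν s : ℝ) : ℂ) * t)‖ = 1 := by
    rw [show Complex.I * ((-ν s : ℝ) : ℂ) * t = ((-ν s * t : ℝ) : ℂ) * Complex.I by
      push_cast; ring]
    exact Complex.norm_exp_ofReal_mul_I _
  rw [← one_mul ‖(∑ j, Complex.exp (Complex.I * (ν j : ℂ) * t) • C j) - _‖, ← h3, ← norm_mul,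
    mul_sub, star_sum, Finset.mul_sum, Finset.mul_sum]
  congr 2
  · refine Finset.sum_congr rfl fun j _ => ?_
    rw [smul_eq_mul, smul_eq_mul, ← mul_assoc, ← Complex.exp_add]
    congr 2
    push_cast; ring
  · refine Finset.sum_congr rfl fun j _ => ?_
    rw [smul_eq_mul, smul_eq_mul, StarMul.star_mul, mul_comm (star (C j)), ← mul_assoc,
      ← starRingEnd_apply (Complex.exp _), ← Complex.exp_conj, ← Complex.exp_add]
    congr 2
    simp only [map_mul, Complex.conj_I, Complex.conj_ofReal]
    push_cast; ring

/-- The Gaussian filter: if the imaginary part of a trigonometric sum vanishes at the time zero,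
then the real parts of its coefficients, weighted by the smoothed signs of the frequencies, have a
small sum. -/
theorem abs_sum_re_mul_smoothSign_le {α : ℝ} (hα : 0 < α) (hε : 0 ≤ ε)
    (hF : ∀ t : ℝ, 0 ≤ t → ‖(∑ j, Complex.exp (Complex.I * (ν j : ℂ) * t) • C j) -
      star (∑ j, Complex.exp (Complex.I * (ν j : ℂ) * t) • C j)‖ ≤ min t 1 * ε)
    (hF' : ∀ t : ℝ, 0 ≤ t → ‖(∑ j, Complex.exp (Complex.I * (ν j : ℂ) * ((-t : ℝ) : ℂ)) • C j) -
      star (∑ j, Complex.exp (Complex.I * (ν j : ℂ) * ((-t : ℝ) : ℂ)) • C j)‖ ≤ min t 1 * ε) :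
    |∑ j, (C j).re * smoothSign α (-ν j)| ≤
      ε / (2 * Real.pi) * (3 + Real.log (max 1 α⁻¹)) := by
  have him : ∀ t : ℝ, (∑ j, Complex.exp (Complex.I * (ν j : ℂ) * t) • C j).im =
      ∑ j, ((C j).re * Real.sin (ν j * t) + (C j).im * Real.cos (ν j * t)) := by
    intro t
    rw [Complex.im_sum]
    refine Finset.sum_congr rfl fun j _ => ?_
    rw [show Complex.I * (ν j : ℂ) * t = ((ν j * t : ℝ) : ℂ) * Complex.I by push_cast; ring,
      smul_eq_mul, Complex.mul_im, Complex.exp_ofReal_mul_I_re, Complex.exp_ofReal_mul_I_im]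
    ring
  have habs : ∀ z : ℂ, ‖z - star z‖ = 2 * |z.im| := by
    intro z
    rw [← starRingEnd_apply, Complex.sub_conj]
    simp
  simp only [habs, him] at hF hF'
  set g : ℝ → ℝ := fun t => ∑ j, (C j).re * Real.sin (-ν j * t) with hgdef
  have hg : ∀ t, 0 ≤ t → |g t| ≤ min t 1 * (ε / 2) := by
    intro t ht
    have h1 := hF t ht
    have h2 := hF' t ht
    -- The difference between the times `-t` and `t` cancels the cosine terms, which carry the
    -- imaginary parts of the coefficients.
    have h3 : 2 * g t =
        (∑ j, ((C j).re * Real.sin (ν j * -t) + (C j).im * Real.cos (ν j * -t))) -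
        ∑ j, ((C j).re * Real.sin (ν j * t) + (C j).im * Real.cos (ν j * t)) := by
      rw [← Finset.sum_sub_distrib, hgdef, Finset.mul_sum]
      refine Finset.sum_congr rfl fun j _ => ?_
      rw [mul_neg, neg_mul, Real.sin_neg, Real.cos_neg]
      ring
    have h4 := abs_sub (∑ j, ((C j).re * Real.sin (ν j * -t) + (C j).im * Real.cos (ν j * -t)))
      (∑ j, ((C j).re * Real.sin (ν j * t) + (C j).im * Real.cos (ν j * t)))
    rw [← h3, abs_mul, abs_two] at h4
    linarith
  have hsum : ∀ t, g t / t * Real.exp (-α * t ^ 2) =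
      ∑ j, (C j).re * (Real.sin (-ν j * t) / t * Real.exp (-α * t ^ 2)) := by
    intro t
    rw [hgdef, Finset.sum_div, Finset.sum_mul]
    refine Finset.sum_congr rfl fun j _ => ?_
    ring
  have hint : ∀ j, MeasureTheory.IntegrableOn
      (fun t => (C j).re * (Real.sin (-ν j * t) / t * Real.exp (-α * t ^ 2))) (Set.Ioi 0) :=
    fun j => ((integrable_sin_div_mul_gaussian hα (-ν j)).const_mul _).integrableOn
  have h := abs_integral_div_mul_gaussian_le hα (g := g) (η := ε / 2) (by positivity) (by
    simp only [hsum]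
    exact MeasureTheory.integrable_finsetSum _ fun j _ => hint j) hg
  simp only [hsum] at h
  rw [MeasureTheory.integral_finsetSum _ fun j _ => hint j] at h
  simp only [MeasureTheory.integral_const_mul, integral_Ioi_sin_div_mul_gaussian hα] at h
  have h5 : ∑ j, (C j).re * (Real.pi / 2 * smoothSign α (-ν j)) =
      Real.pi / 2 * ∑ j, (C j).re * smoothSign α (-ν j) := by
    rw [Finset.mul_sum]
    refine Finset.sum_congr rfl fun j _ => ?_
    ring
  have hpi := Real.pi_pos
  rw [h5, abs_mul, abs_of_pos (by positivity : 0 < Real.pi / 2)] at h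
  rw [div_mul_eq_mul_div, le_div_iff₀ (by positivity)]
  linarith

/-- Each weight `1` is written as the smoothed sign plus a remainder. The filter controls the first
part. The remainder is at most `2` in modulus up to `κ`, where levels are counted, and above `κ` it
is left to `hhigh`, so that the number of high levels does not enter. -/
theorem norm_sum_erase_le_of_filter [DecidableEq n] {α κ δ : ℝ} (hα : 0 < α) (hκ : 0 < κ)
    (hε : 0 ≤ ε)
    (hF : ∀ t : ℝ, 0 ≤ t → ‖(∑ j, Complex.exp (Complex.I * (ν j : ℂ) * t) • C j) -
      star (∑ j, Complex.exp (Complex.I * (ν j : ℂ) * t) • C j)‖ ≤ min t 1 * ε)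
    (hF' : ∀ t : ℝ, 0 ≤ t → ‖(∑ j, Complex.exp (Complex.I * (ν j : ℂ) * ((-t : ℝ) : ℂ)) • C j) -
      star (∑ j, Complex.exp (Complex.I * (ν j : ℂ) * ((-t : ℝ) : ℂ)) • C j)‖ ≤ min t 1 * ε)
    {k : n} (hk : ν k = 0) (hCk : (C k).im = 0) (hC : ∀ r, r ≠ k → ‖C r‖ ≤ ε)
    (hhigh : ‖∑ j, (if κ < -ν j then ((1 - smoothSign α (-ν j) : ℝ) : ℂ) else 0) * C j‖ ≤ δ) :
    ‖∑ j ∈ Finset.univ.erase k, C j‖ ≤ ε / (2 * Real.pi) * (3 + Real.log (max 1 α⁻¹)) +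
      2 * ε * ((Nat.card {j // -ν j ≤ κ} : ℝ) - 1) + δ := by
  -- At `t = 0` the factor `min t 1` vanishes, so the full sum is real, and so is `C k`.
  have hreal : (∑ j ∈ Finset.univ.erase k, C j).im = 0 := by
    have h := hF 0 le_rfl
    simp only [Complex.ofReal_zero, mul_zero, Complex.exp_zero, one_smul,
      min_eq_left (zero_le_one (α := ℝ)), zero_mul, norm_le_zero_iff] at h
    rw [← starRingEnd_apply, sub_eq_zero, eq_comm, Complex.conj_eq_iff_im,
      ← Finset.add_sum_erase _ _ (Finset.mem_univ k), Complex.add_im, hCk, zero_add] at h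
    exact h
  have hnorm : ‖∑ j ∈ Finset.univ.erase k, C j‖ = |∑ j ∈ Finset.univ.erase k, (C j).re| := by
    rw [← Complex.re_sum, Complex.abs_re_eq_norm.2 hreal]
  have hmain := abs_sum_re_mul_smoothSign_le hα hε hF hF'
  rw [← Finset.add_sum_erase _ _ (Finset.mem_univ k), hk, neg_zero, smoothSign_zero, mul_zero,
    zero_add] at hmain
  have hsplit : ∑ j ∈ Finset.univ.erase k, (C j).re =
      (∑ j ∈ Finset.univ.erase k, (C j).re * smoothSign α (-ν j)) +
      (∑ j ∈ (Finset.univ.erase k).filter (fun j => -ν j ≤ κ),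
        (C j).re * (1 - smoothSign α (-ν j))) +
      ∑ j ∈ (Finset.univ.erase k).filter (fun j => ¬ -ν j ≤ κ),
        (C j).re * (1 - smoothSign α (-ν j)) := by
    rw [add_assoc, Finset.sum_filter_add_sum_filter_not, ← Finset.sum_add_distrib]
    refine Finset.sum_congr rfl fun j _ => ?_
    ring
  have hlow : |∑ j ∈ (Finset.univ.erase k).filter (fun j => -ν j ≤ κ),
      (C j).re * (1 - smoothSign α (-ν j))| ≤
        2 * ε * ((Nat.card {j // -ν j ≤ κ} : ℝ) - 1) := by
    -- The level `k` has frequency `0 ≤ κ`; it is counted on the right but erased from the sum,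
    -- hence `- 1`.
    have hcard : (((Finset.univ.erase k).filter (fun j => -ν j ≤ κ)).card : ℝ) =
        (Nat.card {j // -ν j ≤ κ} : ℝ) - 1 := by
      have hmem : k ∈ Finset.univ.filter (fun j => -ν j ≤ κ) := by simp [hk, hκ.le]
      rw [Finset.filter_erase, Finset.cast_card_erase_of_mem hmem, Nat.card_eq_fintype_card,
        Fintype.card_subtype]
    refine (Finset.abs_sum_le_sum_abs _ _).trans ?_
    rw [← hcard, mul_comm, ← nsmul_eq_mul]
    refine Finset.sum_le_card_nsmul _ _ _ fun j hj => ?_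
    have hj' : j ≠ k := Finset.ne_of_mem_erase (Finset.mem_of_mem_filter j hj)
    have h1 := (Complex.abs_re_le_norm (C j)).trans (hC j hj')
    have h2 := abs_le.1 (abs_smoothSign_le_one hα (-ν j))
    have h3 : |1 - smoothSign α (-ν j)| ≤ 2 := abs_le.2 ⟨by linarith, by linarith⟩
    rw [abs_mul, mul_comm (2 : ℝ)]
    exact mul_le_mul h1 h3 (abs_nonneg _) hε
  have hhigh' : |∑ j ∈ (Finset.univ.erase k).filter (fun j => ¬ -ν j ≤ κ),
      (C j).re * (1 - smoothSign α (-ν j))| ≤ δ := by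
    refine le_trans (le_of_eq ?_) ((Complex.abs_re_le_norm _).trans hhigh)
    congr 1
    rw [Complex.re_sum, Finset.filter_erase, Finset.erase_eq_of_notMem (by simp [hk, hκ.le]),
      Finset.sum_filter]
    refine Finset.sum_congr rfl fun j _ => ?_
    simp only [not_le]
    split_ifs with h
    · rw [Complex.re_ofReal_mul, mul_comm]
    · simp
  rw [hnorm, hsplit]
  exact (abs_add_three _ _ _).trans (add_le_add (add_le_add hmain hlow) hhigh')

end Filter

/-! ### Clustering below a mobility edge -/

namespace SpinLattice

open Matrix

theorem expDecay_nonneg (μ : ℝ) (D : ℕ∞) : 0 ≤ expDecay μ D := by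
  unfold expDecay
  split_ifs
  · rfl
  · positivity

section State

variable {S : Type*} [Fintype S] [DecidableEq S] {q : ℕ}

theorem trace_vecMulVec_mul (ψ : Conf S q → ℂ) (A : Op S q) :
    (vecMulVec ψ (star ψ) * A).trace = expectation ψ A := by
  rw [vecMulVec_mul, trace_vecMulVec, dotProduct_comm, ← dotProduct_mulVec]
  rfl

theorem conjTranspose_heisenberg {G : Op S q} (hG : G.IsHermitian) (t : ℝ) {A : Op S q}
    (hA : A.IsHermitian) : (heisenberg G t A)ᴴ = heisenberg G t A := by
  unfold heisenberg
  rw [← star_exp hG, star_eq_conjTranspose, conjTranspose_mul, conjTranspose_mul,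
    conjTranspose_conjTranspose, hA.eq, mul_assoc]

theorem expectation_commutator {G : Op S q} (hG : G.IsHermitian) (ψ : Conf S q → ℂ) (t : ℝ)
    {A B : Op S q} (hA : A.IsHermitian) (hB : B.IsHermitian) :
    expectation ψ (heisenberg G t A * B - B * heisenberg G t A) =
      expectation ψ (heisenberg G t A * B) - star (expectation ψ (heisenberg G t A * B)) := by
  rw [expectation_sub, ← expectation_conjTranspose, conjTranspose_mul, hB.eq,
    conjTranspose_heisenberg hG t hA]

theorem expectation_im {ψ : Conf S q → ℂ} {A : Op S q} (hA : A.IsHermitian) :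
    (expectation ψ A).im = 0 := by
  have h := expectation_conjTranspose ψ A
  rw [hA.eq, ← starRingEnd_apply, eq_comm, Complex.conj_eq_iff_im] at h
  exact h

end State

namespace LocalHamiltonian

variable {V ι : Type*} [Fintype V] [DecidableEq V] [Fintype ι] {q : ℕ}
variable (H : LocalHamiltonian V ι q)

theorem norm_commutator_le {Emob c μ : ℝ} (hmob : H.HasMobilityEdge Emob c μ) {X Y : Finset V}
    (hXY : Disjoint X Y) {A B : Op V q} (hA : IsObservableOn X A) (hB : IsObservableOn Y B)
    {ψ : Conf V q → ℂ} {E : ℝ} (hψ : IsUnitVector ψ) (hE : H.IsEigen ψ E) (hEm : E ≤ Emob)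
    {t : ℝ} (ht : 0 ≤ t) :
    ‖expectation ψ (heisenberg H.full t A * B) -
      star (expectation ψ (heisenberg H.full t A * B))‖ ≤
        min t 1 * (c * expDecay μ (H.dist X Y)) := by
  rw [← expectation_commutator H.full_isHermitian ψ t hA.1 hB.1, ← trace_vecMulVec_mul,
    ← mul_assoc]
  refine hmob.2.2 _ (Submodule.subset_span ⟨ψ, ψ, E, E, hE, hE, hEm, hEm, rfl⟩)
    (posSemidef_vecMulVec_self_star ψ) ?_ X Y hXY A B hA hB t ht
  rw [trace_vecMulVec, dotProduct_comm]
  exact hψ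

/-- The correlations of an eigenvector below the mobility edge, for the Gaussian filter of width
`α`. -/
theorem norm_correlation_le_filter {Emob c μ : ℝ} (hmob : H.HasMobilityEdge Emob c μ)
    (hnd : H.NondegenerateEnergies) (hgap : H.NonsymmetricGaps) {X Y : Finset V}
    (hXY : Disjoint X Y) {A B : Op V q} (hA : IsObservableOn X A) (hB : IsObservableOn Y B)
    {ψ : Conf V q → ℂ} {E : ℝ} (hψ : IsUnitVector ψ) (hE : H.IsEigen ψ E) (hEm : E ≤ Emob)
    {κ : ℝ} (hκ : 0 < κ) :
    1 ≤ H.numStates (E + κ) ∧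
    (H.dist X Y = ⊤ → expectation ψ (A * B) - expectation ψ A * expectation ψ B = 0) ∧
    ∀ α : ℝ, 0 < α → ‖expectation ψ (A * B) - expectation ψ A * expectation ψ B‖ ≤
      c * expDecay μ (H.dist X Y) / (2 * Real.pi) * (3 + Real.log (max 1 α⁻¹)) +
      2 * (c * expDecay μ (H.dist X Y)) * ((H.numStates (E + κ) : ℝ) - 1) +
      Real.exp (-(4 * α)⁻¹ * κ ^ 2) := by
  have hG := H.full_isHermitian
  set ε := c * expDecay μ (H.dist X Y) with hεdef
  have hε : 0 ≤ ε := mul_nonneg hmob.1.le (expDecay_nonneg _ _)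
  obtain ⟨k, hk, hP, -⟩ := exists_eigenProj_eq hG hnd hψ hE
  set ν : Conf V q → ℝ := fun j => E - hG.eigenvalues j with hνdef
  set C : Conf V q → ℂ := fun j => expectation ψ (A * hG.eigenProj j * B) with hCdef
  have hexp : ∀ t : ℝ, expectation ψ (heisenberg H.full t A * B) =
      ∑ j, Complex.exp (Complex.I * (ν j : ℂ) * t) • C j := fun t =>
    expectation_heisenberg_of_isEigen hG hnd hψ hE t A B
  -- Exchanging `A` and `B` conjugates the sum and reverses time, so the commutator bound with the
  -- roles exchanged covers negative times.
  have hexp' : ∀ t : ℝ, expectation ψ (heisenberg H.full t B * A) =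
      star (∑ j, Complex.exp (Complex.I * (ν j : ℂ) * ((-t : ℝ) : ℂ)) • C j) := by
    intro t
    rw [expectation_heisenberg_of_isEigen hG hnd hψ hE t B A, star_sum]
    refine Finset.sum_congr rfl fun j _ => ?_
    rw [star_smul, hCdef]
    simp only
    rw [← expectation_conjTranspose, conjTranspose_mul, conjTranspose_mul, hA.1.eq, hB.1.eq,
      (hG.isHermitian_eigenProj j).eq, ← mul_assoc, ← starRingEnd_apply (Complex.exp _),
      ← Complex.exp_conj]
    congr 2
    simp only [map_mul, Complex.conj_I, Complex.conj_ofReal, hνdef]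
    push_cast; ring
  have hF : ∀ t : ℝ, 0 ≤ t → ‖(∑ j, Complex.exp (Complex.I * (ν j : ℂ) * t) • C j) -
      star (∑ j, Complex.exp (Complex.I * (ν j : ℂ) * t) • C j)‖ ≤ min t 1 * ε := by
    intro t ht
    rw [← hexp]
    exact H.norm_commutator_le hmob hXY hA hB hψ hE hEm ht
  have hF' : ∀ t : ℝ, 0 ≤ t →
      ‖(∑ j, Complex.exp (Complex.I * (ν j : ℂ) * ((-t : ℝ) : ℂ)) • C j) -
      star (∑ j, Complex.exp (Complex.I * (ν j : ℂ) * ((-t : ℝ) : ℂ)) • C j)‖ ≤ min t 1 * ε := by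
    intro t ht
    have h := H.norm_commutator_le hmob hXY.symm hB hA hψ hE hEm ht
    rw [H.dist_comm Y X, hexp', star_star, norm_sub_rev] at h
    exact h
  have hνk : ν k = 0 := by simp [hνdef, hk]
  have hν : ∀ r s, r ≠ s → |ν r| ≠ |ν s| := by
    obtain ⟨ζ, hζ, h⟩ := hgap
    intro r s hrs heq
    have h1 := h k r s hrs
    have h2 : ∀ j, |H.energy j - H.energy k| = |ν j| := fun j => by
      rw [hνdef, abs_sub_comm]; simp only [← hk]; rfl
    rw [h2, h2, heq, sub_self, abs_zero] at h1
    linarith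
  have hν0 : ∀ s, s ≠ k → ν s ≠ 0 := fun s hs h =>
    hν s k hs (by rw [h, hνk])
  have hC : ∀ s, s ≠ k → ‖C s‖ ≤ ε := fun s hs =>
    norm_coeff_le_of_norm_sub_conj_le
      (fun t ht => (hF t ht).trans (mul_le_of_le_one_left hε (min_le_right _ _)))
      (fun r hr => hν r s hr) (hν0 s hs)
  have hCk : C k = expectation ψ A * expectation ψ B := by
    have h : ∀ v w : Conf V q → ℂ, star v ⬝ᵥ (A * vecMulVec ψ (star ψ) * B) *ᵥ w =
        (star v ⬝ᵥ A *ᵥ ψ) * (star ψ ⬝ᵥ B *ᵥ w) := by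
      intro v w
      rw [← mulVec_mulVec, ← mulVec_mulVec, vecMulVec_mulVec]
      simp [mulVec_smul, mul_comm]
    simp only [hCdef, hP]
    exact h ψ ψ
  have hsum : expectation ψ (A * B) - expectation ψ A * expectation ψ B =
      ∑ j ∈ Finset.univ.erase k, C j := by
    have h : expectation ψ (A * B) = ∑ j, C j := by
      simp only [hCdef, ← expectationLin_apply]
      rw [← map_sum, ← Finset.sum_mul, ← Finset.mul_sum, hG.sum_eigenProj, mul_one]
    rw [h, ← hCk, ← Finset.add_sum_erase _ _ (Finset.mem_univ k), add_sub_cancel_left]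
  have hcard : H.numStates (E + κ) = Nat.card {j // -ν j ≤ κ} := by
    refine Nat.card_congr (Equiv.subtypeEquivRight fun j => ?_)
    simp only [hνdef, neg_sub, sub_le_iff_le_add']
    rfl
  refine ⟨?_, fun htop => ?_, fun α hα => ?_⟩
  · rw [hcard]
    have : Nonempty {j // -ν j ≤ κ} := ⟨⟨k, by rw [hνk]; simpa using hκ.le⟩⟩
    exact Nat.card_pos
  -- At infinite distance `ε = 0` and every coefficient vanishes; the filter estimate would still
  -- carry its Gaussian term.
  · rw [hsum]
    refine Finset.sum_eq_zero fun j hj => ?_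
    have h := hC j (Finset.ne_of_mem_erase hj)
    rw [hεdef, htop, expDecay, if_pos rfl, mul_zero] at h
    exact norm_le_zero_iff.1 h
  · rw [hsum, hcard]
    refine norm_sum_erase_le_of_filter hα hκ hε hF hF' hνk ?_ hC ?_
    · rw [hCk, Complex.mul_im, expectation_im hA.1, expectation_im hB.1]
      ring
    -- The high levels are treated as one operator `A w(H) B`, whose norm is at most the supremum of
    -- the weights, so nothing is summed over levels.
    · set w : Conf V q → ℂ := fun j =>
        if κ < -ν j then ((1 - smoothSign α (-ν j) : ℝ) : ℂ) else 0
      have h : ∑ j, w j * C j = expectation ψ (A * hG.spectralSum w * B) := by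
        rw [hG.spectralSum_eq_sum, ← expectationLin_apply]
        simp only [Finset.sum_mul, Finset.mul_sum, mul_smul_comm, smul_mul_assoc, map_sum,
          map_smul, expectationLin_apply, smul_eq_mul, hCdef]
      have hw : ‖hG.spectralSum w‖ ≤ Real.exp (-(4 * α)⁻¹ * κ ^ 2) := by
        refine hG.norm_spectralSum_le (Real.exp_pos _).le fun j => ?_
        simp only [w]
        split_ifs with hj
        · rw [Complex.norm_real, Real.norm_of_nonneg (one_sub_smoothSign_nonneg hα _)]
          refine (one_sub_smoothSign_le hα (hκ.trans hj).le).trans ?_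
          have h4 : 0 < (4 * α)⁻¹ := by positivity
          rw [Real.exp_le_exp, neg_mul, neg_mul, neg_le_neg_iff]
          gcongr
        · rw [norm_zero]; exact (Real.exp_pos _).le
      rw [h]
      refine (norm_expectation_le hψ _).trans ((norm_mul_le _ _).trans ?_)
      rw [hB.2.2, mul_one]
      refine (norm_mul_le _ _).trans ?_
      rw [hA.2.2, one_mul]
      exact hw

/-- The clustering of correlations below a mobility edge, with the number of the other
eigenvectors of energy at most `E + κ`. -/
theorem norm_correlation_le_of_mobilityEdge {Emob c μ : ℝ} (hmob : H.HasMobilityEdge Emob c μ)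
    (hnd : H.NondegenerateEnergies) (hgap : H.NonsymmetricGaps) {X Y : Finset V}
    (hXY : Disjoint X Y) {A B : Op V q} (hA : IsObservableOn X A) (hB : IsObservableOn Y B)
    {ψ : Conf V q → ℂ} {E : ℝ} (hψ : IsUnitVector ψ) (hE : H.IsEigen ψ E) (hEm : E ≤ Emob)
    {κ : ℝ} (hκ : 0 < κ) :
    ‖expectation ψ (A * B) - expectation ψ A * expectation ψ B‖ ≤
      (4 * Real.pi * (H.numStates (E + κ) - 1) * c + 2 * Real.pi +
        c * (4 + Real.log (max 1 (Real.pi * μ * (H.dist X Y).toNat / κ ^ 2)))) *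
      (expDecay μ (H.dist X Y) / (2 * Real.pi)) := by
  obtain ⟨-, h0, h⟩ := H.norm_correlation_le_filter hmob hnd hgap hXY hA hB hψ hE hEm hκ
  obtain ⟨hc, hμ, -⟩ := hmob
  have hpi := Real.pi_pos
  by_cases ht : H.dist X Y = ⊤
  · rw [h0 ht, ht, expDecay, if_pos rfl]
    simp
  obtain ⟨m, hm⟩ := ENat.ne_top_iff_exists.1 ht
  have hm1 : (1 : ℝ) ≤ m := by
    have := H.one_le_dist hXY
    rw [← hm] at this
    exact_mod_cast this
  have hD : expDecay μ (H.dist X Y) = Real.exp (-μ * m) := by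
    rw [expDecay, if_neg ht, ← hm, ENat.toNat_natCast]
  have hD0 := Real.exp_pos (-μ * m)
  rw [hD] at h ⊢
  rw [← hm, ENat.toNat_natCast]
  set y : ℝ := Real.pi * μ * m / κ ^ 2 with hy
  have hy0 : 0 < y := by positivity
  have he := Real.exp_pos 1
  -- With this `α` the tail exponent `κ²/(4α)` is `(e π/4) μ d`, at least `μ d` since `e π ≥ 4`. The
  -- factor `e` adds `1` to the logarithm, turning `3` into the `4` of the bound.
  have h1 := h (Real.exp 1 * y)⁻¹ (by positivity)
  rw [inv_inv] at h1
  have hlog : Real.log (max 1 (Real.exp 1 * y)) ≤ 1 + Real.log (max 1 y) := by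
    have hmax : 0 < max 1 y := lt_of_lt_of_le one_pos (le_max_left _ _)
    have : 1 + Real.log (max 1 y) = Real.log (Real.exp 1 * max 1 y) := by
      rw [Real.log_mul he.ne' hmax.ne', Real.log_exp]
    rw [this]
    refine Real.log_le_log (lt_of_lt_of_le one_pos (le_max_left _ _)) (max_le ?_ ?_)
    · calc (1 : ℝ) ≤ Real.exp 1 * 1 := by
            rw [mul_one]; exact Real.one_le_exp zero_le_one
        _ ≤ _ := by gcongr; exact le_max_left _ _
    · gcongr; exact le_max_right _ _
  have hhigh : Real.exp (-(4 * (Real.exp 1 * y)⁻¹)⁻¹ * κ ^ 2) ≤ Real.exp (-μ * m) := by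
    rw [Real.exp_le_exp]
    have h2 : -(4 * (Real.exp 1 * y)⁻¹)⁻¹ * κ ^ 2 = -(Real.exp 1 * Real.pi / 4) * (μ * m) := by
      rw [hy]
      field_simp
    have h3 : 4 ≤ Real.exp 1 * Real.pi := by
      nlinarith [Real.pi_gt_three, Real.add_one_le_exp 1]
    have h4 : 0 < μ * m := by positivity
    rw [h2]
    nlinarith
  calc _ ≤ _ := h1
    _ ≤ c * Real.exp (-μ * m) / (2 * Real.pi) * (3 + (1 + Real.log (max 1 y))) +
      2 * (c * Real.exp (-μ * m)) * ((H.numStates (E + κ) : ℝ) - 1) + Real.exp (-μ * m) := by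
        gcongr
    _ = _ := by field_simp; ring

end LocalHamiltonian

end SpinLattice

/-! ### The theorem -/

theorem theorem1 {V ι : Type*} [Fintype V] [DecidableEq V] [Fintype ι] {q : ℕ}
    (H : SpinLattice.LocalHamiltonian V ι q) :
    -- part a
    (∀ c μ : ℝ, H.StrongDynamicalLocalisation c μ → H.NondegenerateEnergies →
      ∀ X Y : Finset V, Disjoint X Y →
      H.LocallyIndependentGaps (H.halfway X Y) (H.halfway Y X) →
      ∀ A B : SpinLattice.Op V q,
      SpinLattice.IsObservableOn X A → SpinLattice.IsObservableOn Y B →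
      ∀ (ψ : SpinLattice.Conf V q → ℂ) (E : ℝ),
      SpinLattice.IsUnitVector ψ → H.IsEigen ψ E →
        ‖SpinLattice.expectation ψ (A * B)
            - SpinLattice.expectation ψ A * SpinLattice.expectation ψ B‖
          ≤ 4 * c * SpinLattice.expDecay (μ / 2) (H.dist X Y)) ∧
    -- part b
    (∀ Emob c μ : ℝ, H.HasMobilityEdge Emob c μ → H.NondegenerateEnergies →
      H.NonsymmetricGaps →
      ∀ X Y : Finset V, Disjoint X Y → ∀ A B : SpinLattice.Op V q,
      SpinLattice.IsObservableOn X A → SpinLattice.IsObservableOn Y B →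
      ∀ (ψ : SpinLattice.Conf V q → ℂ) (E : ℝ),
      SpinLattice.IsUnitVector ψ → H.IsEigen ψ E → E ≤ Emob →
      ∀ κ : ℝ, 0 < κ →
        ‖SpinLattice.expectation ψ (A * B)
            - SpinLattice.expectation ψ A * SpinLattice.expectation ψ B‖
          ≤ (12 * Real.pi * H.numStates (E + κ) * c + 2 * Real.pi
              + c * Real.log (Real.exp 4
                  * max 1 (Real.pi * μ * (H.dist X Y).toNat / κ ^ 2)))
            * (SpinLattice.expDecay μ (H.dist X Y) / (2 * Real.pi)) ∧
        (1 ≤ Real.pi * μ * (H.dist X Y).toNat * Real.exp 4 / κ ^ 2 →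
          (c ≤ 1 ∨ Real.log (Real.pi * μ * (H.dist X Y).toNat * Real.exp 4 / κ ^ 2)
            ≤ 4 * Real.pi * (2 * H.numStates (E + κ) + 1)) →
          ‖SpinLattice.expectation ψ (A * B)
              - SpinLattice.expectation ψ A * SpinLattice.expectation ψ B‖
            ≤ (12 * Real.pi * H.numStates (E + κ) * c
                + Real.log (Real.pi * μ * (H.dist X Y).toNat
                    * Real.exp (4 + 2 * Real.pi) / κ ^ 2))
              * (SpinLattice.expDecay μ (H.dist X Y) / (2 * Real.pi)))) := by
  refine ⟨fun c μ hloc hnd X Y hXY hgap A B hA hB ψ E hψ hE =>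
    H.norm_correlation_le_of_localised hloc hnd hXY hgap hA hB hψ hE, ?_⟩
  intro Emob c μ hmob hnd hgap X Y hXY A B hA hB ψ E hψ hE hEm κ hκ
  have h := H.norm_correlation_le_of_mobilityEdge hmob hnd hgap hXY hA hB hψ hE hEm hκ
  have hΘ : (1 : ℝ) ≤ H.numStates (E + κ) := by
    exact_mod_cast (H.norm_correlation_le_filter hmob hnd hgap hXY hA hB hψ hE hEm hκ).1
  have hc := hmob.1
  have hpi := Real.pi_pos
  have hD : 0 ≤ SpinLattice.expDecay μ (H.dist X Y) / (2 * Real.pi) :=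
    div_nonneg (SpinLattice.expDecay_nonneg _ _) (by positivity)
  set Θ : ℝ := Nat.cast (H.numStates (E + κ))
  set y : ℝ := Real.pi * μ * (H.dist X Y).toNat / κ ^ 2 with hy
  have hmax : 0 < max 1 y := lt_of_lt_of_le one_pos (le_max_left _ _)
  have hcΘ : 0 ≤ Real.pi * c * Θ := by positivity
  have hpc : 0 ≤ Real.pi * c := by positivity
  refine ⟨h.trans (mul_le_mul_of_nonneg_right ?_ hD), fun h1 h2 =>
    h.trans (mul_le_mul_of_nonneg_right ?_ hD)⟩
  · rw [Real.log_mul (Real.exp_pos 4).ne' hmax.ne', Real.log_exp]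
    nlinarith
  · have hy4 : Real.pi * μ * (H.dist X Y).toNat * Real.exp 4 / κ ^ 2 = y * Real.exp 4 := by
      rw [hy]; ring
    have hy4' : Real.pi * μ * (H.dist X Y).toNat * Real.exp (4 + 2 * Real.pi) / κ ^ 2 =
        y * Real.exp (4 + 2 * Real.pi) := by
      rw [hy]; ring
    rw [hy4] at h1 h2
    -- Since `toNat` sends `⊤` to `0`, `h1` also forces the distance to be finite.
    have hy0 : 0 < y := pos_of_mul_pos_left (one_pos.trans_le h1) (Real.exp_pos 4).le
    have hL0 : 0 ≤ Real.log (y * Real.exp 4) := Real.log_nonneg h1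
    rw [Real.log_mul hy0.ne' (Real.exp_pos _).ne', Real.log_exp] at h2 hL0
    rw [hy4', Real.log_mul hy0.ne' (Real.exp_pos _).ne', Real.log_exp]
    have hpi3 := Real.pi_gt_three
    rcases le_total y 1 with hy1 | hy1
    -- Passing from `4π(Θ - 1)c` to `12πΘc` leaves a slack of `4π(2Θ + 1)c`, which here absorbs
    -- `4c`.
    · rw [max_eq_left hy1, Real.log_one]
      nlinarith
    · rw [max_eq_right hy1]
      -- With `L = log (y e⁴)`, what is needed is `c L ≤ L + 4π(2Θ + 1)c`: the first term on the
      -- right suffices if `c ≤ 1`, and the slack does otherwise.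
      rcases h2 with h2 | h2
      · nlinarith [mul_nonneg (sub_nonneg.2 h2) hL0]
      · nlinarith [mul_le_mul_of_nonneg_left h2 hc.le]
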